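/- Let $\mathbb{K}\in\{\mathbb{R},\mathbb{C}\}$ and let $T$ be the $C_0$-semigroup on $L_2(0,\infty)$ (with scalars $\mathbb{K}$) generated by the Dirichlet Laplacian $\Delta_{\mathrm D}$ on $(0,\infty)$, where $\operatorname{dom}(\Delta_{\mathrm D})=\{u\in H_0^1(0,\infty): u''\in L_2(0,\infty)\}$ and $\Delta_{\mathrm D}u=u''$ (distributional derivative). For a bounded measurable $W\colon(0,\infty)\to\mathbb{R}$ let $T_W$ be the $C_0$-semigroup generated by $\Delta_{\mathrm D}-W$. For a measurable $V\colon(0,\infty)\to\mathbb{R}$ put $V_n:=(V\wedge n)\vee(-n)$ $(n\in\mathbb{N})$. If $V\geqslant0$ or $V\leqslant0$, then $V$ is called $T$-admissible if $T_V(t):=\lim_{n\to\infty}T_{V_n}(t)$ exists in the strong operator topology for all $t\geqslant0$ and $T_V$ is a $C_0$-semigroup on $L_2(0,\infty)$. In general, $V$ is called $T$-admissible if $V^+=V\vee0$ and $-V^-=V\wedge0$ are $T$-admissible; then the strong limit $T_V(t):=\lim_{n\to\infty}T_{V_n}(t)$ exists for all $t\geqslant0$ and $T_V$ is a $C_0$-semigroup.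 For $\xi\in\mathbb{R}$ let $\rho_\xi(x):=e^{\xi x}$ $(x>0)$, and for a bounded linear operator $A$ on $L_2(0,\infty)$ let \[ \|\rho_\xi A\rho_\xi^{-1}\|_{1\to1}:=\sup\bigl\{\|\rho_\xi A(\rho_\xi^{-1}f)\|_{L_1(0,\infty)} : f\in L_1(0,\infty),\ \|f\|_{L_1(0,\infty)}\leqslant1,\ \rho_\xi^{-1}f\in L_2(0,\infty)\bigr\}\in[0,\infty]. \] **Proposition.** Let $V\colon(0,\infty)\to\mathbb{R}$ be measurable and let $\alpha\in(0,1)$ be such that \[ \int_0^\infty x\,|V(x)|\,dx\leqslant\alpha . \] Then $V$ is $T$-admissible (so that the $C_0$-semigroup $T_V$ is defined), and for every $\xi\in\mathbb{R}$, \[ \|\rho_\xi T_V(t)\rho_\xi^{-1}\|_{1\to1}\leqslant\frac{1}{1-\alpha}\,e^{|\xi|^2t}\qquad(t\geqslant0). \] -/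

import Mathlib

open MeasureTheory Set Filter Topology
open scoped NNReal ENNReal ContDiff

/-- A `C₀`-semigroup of bounded linear operators on a normed space `X`. -/
structure C0Semigroup (𝕜 X : Type*) [RCLike 𝕜] [NormedAddCommGroup X] [NormedSpace 𝕜 X] where
  /-- the operator `T(t)`, `t ≥ 0` -/
  op : ℝ≥0 → X →L[𝕜] X
  op_zero : op 0 = ContinuousLinearMap.id 𝕜 X
  op_add : ∀ s t : ℝ≥0, op (s + t) = (op s).comp (op t)
  continuous_orbit : ∀ x : X, Continuous fun t : ℝ≥0 => op t x

namespace C0Semigroup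

/-- The graph of the generator of `T`: all pairs `(x, y)` such that `h⁻¹ (T(h) x - x)` converges
to `y` in `X` as `h → 0+`. -/
def generatorGraph {𝕜 X : Type*} [RCLike 𝕜] [NormedAddCommGroup X] [NormedSpace 𝕜 X]
    (T : C0Semigroup 𝕜 X) : Set (X × X) :=
  {q | Tendsto (fun h : ℝ≥0 => (((h : ℝ)⁻¹ : ℝ) : 𝕜) • (T.op h q.1 - q.1)) (𝓝[>] 0) (𝓝 q.2)}

variable {𝕜 Ω : Type*} [RCLike 𝕜] [MeasurableSpace Ω] {μ : Measure Ω} {p : ℝ≥0∞} [Fact (1 ≤ p)]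

/-- `S` is the `C₀`-semigroup `T_W` generated by `A - W`, where `A` is the generator of `T` and
`W` is a (bounded) potential, acting as a multiplication operator; `dom (A - W) = dom A`. -/
def IsBoundedPerturbation (T : C0Semigroup 𝕜 (Lp 𝕜 p μ)) (W : Ω → ℝ)
    (S : C0Semigroup 𝕜 (Lp 𝕜 p μ)) : Prop :=
  S.generatorGraph = {q | ∃ g : Lp 𝕜 p μ, (q.1, g) ∈ T.generatorGraph ∧
    ∀ᵐ x ∂μ, q.2 x = g x - (W x : 𝕜) * q.1 x}

/-- The truncated potential `(V ∧ n) ∨ (-n)`. It is `V ∧ n` for `V ≥ 0` and `V ∨ (-n)` for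
`V ≤ 0`. -/
def truncation (V : Ω → ℝ) (n : ℕ) : Ω → ℝ := fun x => max (min (V x) n) (-(n : ℝ))

/-- `S` is a `C₀`-semigroup and `S(t)` is, for all `t ≥ 0`, the strong limit of
`T_{(V ∧ n) ∨ (-n)}(t)` as `n → ∞`; that is, `S = T_V`. -/
def IsPerturbation (T : C0Semigroup 𝕜 (Lp 𝕜 p μ)) (V : Ω → ℝ)
    (S : C0Semigroup 𝕜 (Lp 𝕜 p μ)) : Prop :=
  ∃ R : ℕ → C0Semigroup 𝕜 (Lp 𝕜 p μ),
    (∀ n, T.IsBoundedPerturbation (truncation V n) (R n)) ∧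
    ∀ (t : ℝ≥0) (f : Lp 𝕜 p μ), Tendsto (fun n => (R n).op t f) atTop (𝓝 (S.op t f))

/-- `V` is `T`-admissible: for each of the potentials `V⁺ ≥ 0` and `-V⁻ ≤ 0`, the semigroups of
the truncated potentials converge strongly to a `C₀`-semigroup. -/
def IsAdmissible (T : C0Semigroup 𝕜 (Lp 𝕜 p μ)) (V : Ω → ℝ) : Prop :=
  (∃ S, T.IsPerturbation (fun x => max (V x) 0) S) ∧
  (∃ S, T.IsPerturbation (fun x => min (V x) 0) S)

end C0Semigroup

/-- The norm `‖ρ A ρ⁻¹‖_{L_q(μ) → L_r(μ)} ∈ [0, ∞]` for an operator `A` on `L_p(μ)` and a weight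
`ρ > 0`: the supremum of `‖ρ A (ρ⁻¹ f)‖_r` over all `f ∈ L_q(μ)` with `‖f‖_q ≤ 1` and
`ρ⁻¹ f ∈ L_p(μ)`. -/
noncomputable def weightedOpNorm {𝕜 Ω : Type*} [RCLike 𝕜] [MeasurableSpace Ω] {μ : Measure Ω}
    {p : ℝ≥0∞} [Fact (1 ≤ p)] (ρ : Ω → ℝ) (A : Lp 𝕜 p μ →L[𝕜] Lp 𝕜 p μ) (q r : ℝ≥0∞) : ℝ≥0∞ :=
  ⨆ (f : Ω → 𝕜) (_ : MemLp f q μ) (_ : eLpNorm f q μ ≤ 1)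
    (hf : MemLp (fun x => ((ρ x : 𝕜))⁻¹ * f x) p μ),
    eLpNorm (fun x => (ρ x : 𝕜) * A (hf.toLp _) x) r μ

/-- Lebesgue measure on `(0, ∞)`. -/
noncomputable abbrev halfLineMeasure : Measure ℝ := volume.restrict (Ioi (0 : ℝ))

/-- The space `L_2(0, ∞)` with scalars `𝕜`. -/
abbrev HalfLineL2 (𝕜 : Type*) [RCLike 𝕜] : Type _ := Lp 𝕜 2 halfLineMeasure

/-- `φ ∈ C_c^∞(0, ∞)`. -/
def IsHalfLineTest {𝕜 : Type*} [RCLike 𝕜] (φ : ℝ → 𝕜) : Prop :=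
  ContDiff ℝ ∞ φ ∧ HasCompactSupport φ ∧ tsupport φ ⊆ Ioi (0 : ℝ)

/-- `u ∈ H_0^1(0, ∞)`: `u` lies in the closure of `C_c^∞(0, ∞)` with respect to the `H^1`-norm,
i.e. there are test functions `φ n` such that `φ n → u` and `(φ n)' → w` in `L_2(0, ∞)` for some
`w` (which is then the weak derivative of `u`). -/
def MemH10 {𝕜 : Type*} [RCLike 𝕜] (u : HalfLineL2 𝕜) : Prop :=
  ∃ (w : HalfLineL2 𝕜) (φ : ℕ → ℝ → 𝕜), (∀ n, IsHalfLineTest (φ n)) ∧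
    Tendsto (fun n => eLpNorm (fun x => φ n x - u x) 2 halfLineMeasure) atTop (𝓝 0) ∧
    Tendsto (fun n => eLpNorm (fun x => deriv (φ n) x - w x) 2 halfLineMeasure) atTop (𝓝 0)

/-- The graph of the Dirichlet Laplacian on `(0, ∞)`: all pairs `(u, v)` of elements of
`L_2(0, ∞)` with `u ∈ H_0^1(0, ∞)` and `u'' = v` in the sense of distributions on `(0, ∞)`. -/
def dirichletLaplacianGraph (𝕜 : Type*) [RCLike 𝕜] : Set (HalfLineL2 𝕜 × HalfLineL2 𝕜) :=
  {q | MemH10 q.1 ∧ ∀ φ : ℝ → 𝕜, IsHalfLineTest φ →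
    ∫ x in Ioi (0 : ℝ), q.1 x * deriv (deriv φ) x = ∫ x in Ioi (0 : ℝ), q.2 x * φ x}

/-! Two separate arguments use the first moment ∫ x|V| ≤ α < 1.

Existence of T_V. A function u in H_0^1 vanishes at 0, so |u(x)|² ≤ x‖u'‖² by Cauchy–Schwarz, and
hence ∫|W||u|² ≤ α‖u'‖² whenever W has first moment at most α: such a potential is form-small with
respect to the Dirichlet Laplacian. A Lyapunov functional turns this into ‖T_{W₁}(t) − T_{W₂}(t)‖ ≤
ε/(2(1−α)), uniformly in t, where ε is the first moment of W₁ − W₂ (`norm_op_sub_op_le`). The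
semigroups of the truncations are therefore Cauchy. The same estimate allows V to be replaced by a
smooth potential q later on. The approximating semigroups themselves come from the bounded
perturbation theorem (`exists_perturbation`).

Weighted estimate. Let ρ ≥ 0 be a supersolution, ρ'' + Qρ ≤ κ²ρ, with |W| ≤ Q. Kato's inequality,
formally Re⟨ρ sgn u, u''⟩ ≤ ∫ρ''|u|, shows that ∫ρ|u| grows at most like exp(κ²t) along the orbits
of T_W. No boundary condition on ρ is needed, because u vanishes at 0. If moreover b ≤ ρ ≤ b/(1−α),
the L_1(b)-norm of T_W(t) is at most exp(κ²t)/(1−α).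

Such a ρ exists (`exists_superWeight`) when b'' ≤ κ²b and b(y) ≤ exp(κ|x−y|) b(x). Let z solve κ²z −
z'' = Qb with z(0) = 0. The Green kernel κ⁻¹ sinh(κ min(x,y)) exp(−κ max(x,y)) is at most min(x,y)
exp(−κ|x−y|), so z ≤ αb, and ρ = b + z/(1−α) has all the required properties. The weight exp(ξx)
need not be bounded or integrable; b is a damped version of it (`baseWeight`), and Fatou's lemma
removes the damping. -/

theorem hasDerivWithinAt_norm_sq_rclike {𝕜 H : Type*} [RCLike 𝕜] [NormedAddCommGroup H]
    [InnerProductSpace 𝕜 H] [NormedSpace ℝ H] {u : ℝ → H} {u' : H} {s : Set ℝ} {t : ℝ}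
    (h : HasDerivWithinAt u u' s t) :
    HasDerivWithinAt (fun r => ‖u r‖ ^ 2) (2 * RCLike.re (inner 𝕜 (u t) u')) s t := by
  have h1 := (RCLike.reCLM (K := 𝕜)).hasFDerivAt.comp_hasDerivWithinAt t (h.inner 𝕜 h)
  have e : ∀ r, ((RCLike.reCLM (K := 𝕜)) ∘ fun t => inner 𝕜 (u t) (u t)) r = ‖u r‖ ^ 2 := fun r => by
    simp
  refine (h1.congr (fun r _ => (e r).symm) (e t).symm).congr_deriv ?_
  simp only [RCLike.reCLM_apply, map_add]
  rw [← inner_conj_symm u' (u t), RCLike.conj_re]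
  ring

/-! ### Orbits, generators and Gronwall estimates -/

namespace C0Semigroup

section Orbits

variable {𝕜 X : Type*} [RCLike 𝕜] [NormedAddCommGroup X] [NormedSpace 𝕜 X]

theorem continuous_orbit_toNNReal (R : C0Semigroup 𝕜 X) (x : X) :
    Continuous fun s : ℝ => R.op s.toNNReal x :=
  (R.continuous_orbit x).comp continuous_real_toNNReal

theorem op_add_apply (R : C0Semigroup 𝕜 X) (s t : ℝ≥0) (x : X) :
    R.op (s + t) x = R.op s (R.op t x) := by
  rw [R.op_add]; rfl

theorem op_zero_apply (R : C0Semigroup 𝕜 X) (x : X) : R.op 0 x = x := by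
  rw [R.op_zero]; rfl

theorem op_comm_apply (R : C0Semigroup 𝕜 X) (s t : ℝ≥0) (x : X) :
    R.op s (R.op t x) = R.op t (R.op s x) := by
  rw [← op_add_apply, add_comm, op_add_apply]

variable [NormedSpace ℝ X] [IsScalarTower ℝ 𝕜 X]

/-- The generator is the right derivative of the orbits at `0`. -/
theorem mem_generatorGraph_iff (R : C0Semigroup 𝕜 X) (x y : X) :
    (x, y) ∈ R.generatorGraph ↔
      HasDerivWithinAt (fun s : ℝ => R.op s.toNNReal x) y (Ici 0) 0 := by
  rw [← hasDerivWithinAt_Ioi_iff_Ici, hasDerivWithinAt_iff_tendsto_slope' (by simp)]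
  have key : ∀ h : ℝ≥0, (((h : ℝ)⁻¹ : ℝ) : 𝕜) • (R.op h x - x)
      = slope (fun s : ℝ => R.op s.toNNReal x) 0 (h : ℝ) := by
    intro h
    rw [← RCLike.real_smul_eq_coe_smul (K := 𝕜)]
    simp [slope_def_module, op_zero_apply]
  constructor
  · intro h
    have h' : Tendsto (fun h : ℝ≥0 => (((h : ℝ)⁻¹ : ℝ) : 𝕜) • (R.op h x - x)) (𝓝[>] 0) (𝓝 y) := h
    simp only [key] at h'
    have hc : Tendsto Real.toNNReal (𝓝[>] (0 : ℝ)) (𝓝[>] (0 : ℝ≥0)) := by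
      refine tendsto_nhdsWithin_of_tendsto_nhds_of_eventually_within _ ?_ ?_
      · have : Tendsto Real.toNNReal (𝓝 (0 : ℝ)) (𝓝 (Real.toNNReal 0)) :=
          continuous_real_toNNReal.tendsto _
        rw [Real.toNNReal_zero] at this
        exact this.mono_left nhdsWithin_le_nhds
      · filter_upwards [self_mem_nhdsWithin] with s hs
        simpa using hs
    refine (h'.comp hc).congr' ?_
    filter_upwards [self_mem_nhdsWithin] with s hs
    simp [Real.coe_toNNReal s (le_of_lt hs)]
  · intro h
    show Tendsto (fun h : ℝ≥0 => (((h : ℝ)⁻¹ : ℝ) : 𝕜) • (R.op h x - x)) (𝓝[>] 0) (𝓝 y)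
    simp only [key]
    refine h.comp (tendsto_nhdsWithin_of_tendsto_nhds_of_eventually_within _ ?_ ?_)
    · exact (NNReal.continuous_coe.tendsto' 0 0 rfl).mono_left nhdsWithin_le_nhds
    · filter_upwards [self_mem_nhdsWithin] with s hs
      simpa using hs

theorem op_mem_generatorGraph (R : C0Semigroup 𝕜 X) {x y : X} (h : (x, y) ∈ R.generatorGraph)
    (t : ℝ≥0) : (R.op t x, R.op t y) ∈ R.generatorGraph := by
  rw [mem_generatorGraph_iff] at h ⊢
  have := ((R.op t).restrictScalars ℝ).hasFDerivAt.comp_hasDerivWithinAt (0 : ℝ) h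
  refine this.congr (fun s _ => ?_) ?_ <;> simp [op_comm_apply R _ t]

/-- Orbits starting in the domain of the generator are differentiable from the right. -/
theorem hasDerivWithinAt_orbit (R : C0Semigroup 𝕜 X) {x y : X} (h : (x, y) ∈ R.generatorGraph)
    {t : ℝ} (ht : 0 ≤ t) :
    HasDerivWithinAt (fun s : ℝ => R.op s.toNNReal x) (R.op t.toNNReal y) (Ici t) t := by
  have h1 := (R.mem_generatorGraph_iff _ _).1 (R.op_mem_generatorGraph h t.toNNReal)
  have h2 : HasDerivWithinAt (fun s : ℝ => s - t) 1 (Ici t) t :=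
    ((hasDerivAt_id t).sub_const t).hasDerivWithinAt
  have h3 := HasDerivWithinAt.scomp (h := fun s : ℝ => s - t) (t' := Ici 0) t
    (by simpa using h1) h2 (fun s hs => by simpa using hs)
  rw [one_smul] at h3
  have key : ∀ s ∈ Ici t, R.op s.toNNReal x
      = ((fun s : ℝ => R.op s.toNNReal (R.op t.toNNReal x)) ∘ fun s => s - t) s := by
    intro s hs
    have hs' : 0 ≤ s - t := sub_nonneg.2 hs
    simp only [Function.comp]
    rw [← op_add_apply, ← Real.toNNReal_add hs' ht, sub_add_cancel]
  exact h3.congr key (key t self_mem_Ici)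

theorem sub_mem_generatorGraph (R : C0Semigroup 𝕜 X) {x y x' y' : X}
    (h : (x, y) ∈ R.generatorGraph) (h' : (x', y') ∈ R.generatorGraph) :
    (x - x', y - y') ∈ R.generatorGraph := by
  rw [mem_generatorGraph_iff] at *
  refine (h.sub h').congr_of_eventuallyEq (Eventually.of_forall fun s => ?_) ?_ <;> simp

/-- The averages h⁻¹ ∫₀ʰ R(s)x ds lie in the domain, since R(k) only shifts the interval of
integration, and they tend to x as h → 0. -/
theorem dense_domain [CompleteSpace X] (R : C0Semigroup 𝕜 X) :
    Dense {x : X | ∃ y, (x, y) ∈ R.generatorGraph} := by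
  intro x
  set g : ℝ → X := fun s => R.op s.toNNReal x with hg
  have hgc : Continuous g := R.continuous_orbit_toNNReal x
  have hF : ∀ b, HasDerivAt (fun u => ∫ s in (0 : ℝ)..u, g s) (g b) b := fun b =>
    (hgc.integral_hasStrictDerivAt 0 b).hasDerivAt
  have hmem : ∀ h : ℝ, 0 < h → h⁻¹ • (∫ s in (0 : ℝ)..h, g s) ∈
      {x : X | ∃ y, (x, y) ∈ R.generatorGraph} := by
    intro h hh
    refine ⟨h⁻¹ • (g h - g 0), (R.mem_generatorGraph_iff _ _).2 ?_⟩
    have h1 : HasDerivAt (fun k : ℝ => h⁻¹ • ((∫ s in (0 : ℝ)..(h + k), g s) - ∫ s in (0 : ℝ)..k, g s))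
        (h⁻¹ • (g h - g 0)) 0 := by
      have h2 : HasDerivAt (fun k : ℝ => ∫ s in (0 : ℝ)..(h + k), g s) (g h) 0 := by
        have := HasDerivAt.scomp (h := fun k : ℝ => h + k) (0 : ℝ) (hF (h + 0))
          ((hasDerivAt_id (0 : ℝ)).const_add h)
        simpa [Function.comp_def] using this
      exact (h2.sub (hF 0)).const_smul _
    refine h1.hasDerivWithinAt.congr (fun k hk => ?_) ?_
    · have hk : 0 ≤ k := hk
      have hint : ∀ a b : ℝ, IntervalIntegrable g volume a b := fun a b => hgc.intervalIntegrable a b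
      have e1 : R.op k.toNNReal (∫ s in (0 : ℝ)..h, g s) = ∫ s in (0 : ℝ)..h, g (s + k) := by
        rw [← ContinuousLinearMap.intervalIntegral_comp_comm _ (hint 0 h)]
        refine intervalIntegral.integral_congr fun s hs => ?_
        have hs0 : 0 ≤ s := by
          rw [uIcc_of_le hh.le] at hs; exact hs.1
        simp only [hg]
        rw [Real.toNNReal_add hs0 hk, add_comm, op_add_apply]
      have e2 : (h⁻¹ : ℝ) • (∫ s in (0 : ℝ)..h, g s) = ((h⁻¹ : ℝ) : 𝕜) • (∫ s in (0 : ℝ)..h, g s) :=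
        RCLike.real_smul_eq_coe_smul _ _
      rw [e2, map_smul, e1, ← RCLike.real_smul_eq_coe_smul (K := 𝕜),
        intervalIntegral.integral_comp_add_right, zero_add,
        ← intervalIntegral.integral_interval_sub_left (hint 0 _) (hint 0 _)]
    · simp [op_zero_apply]
  have hlim : Tendsto (fun h : ℝ => h⁻¹ • (∫ s in (0 : ℝ)..h, g s)) (𝓝[>] 0) (𝓝 x) := by
    have := (hasDerivWithinAt_iff_tendsto_slope' (by simp)).1
      ((hF 0).hasDerivWithinAt (s := Ioi 0))
    have hg0 : g 0 = x := by simp [hg, op_zero_apply]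
    rw [hg0] at this
    refine this.congr fun h => ?_
    simp [slope_def_module]
  exact mem_closure_of_tendsto hlim (by filter_upwards [self_mem_nhdsWithin] with h hh using hmem h hh)

end Orbits

section Lyapunov

variable {𝕜 H : Type*} [RCLike 𝕜] [NormedAddCommGroup H] [InnerProductSpace 𝕜 H]
  [NormedSpace ℝ H] [IsScalarTower ℝ 𝕜 H] [CompleteSpace H]

local notation "⟪" x ", " y "⟫" => inner 𝕜 x y

theorem gronwallBound_eq_add (δ K ε x : ℝ) :
    gronwallBound δ K ε x = δ * Real.exp (K * x) + gronwallBound 0 K ε x := by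
  unfold gronwallBound
  split_ifs with h <;> simp [h]

/-- A Gronwall estimate for a convex functional `F` with gradient `G` along the orbits. -/
theorem le_gronwallBound_of_convex (R : C0Semigroup 𝕜 H) {F : H → ℝ} {G : H → H}
    (hF : Continuous F) (hG : Continuous G) (hFG : ∀ a b, F a - F b ≤ RCLike.re ⟪G a, a - b⟫)
    {K ε : ℝ} (hgen : ∀ x y, (x, y) ∈ R.generatorGraph → RCLike.re ⟪G x, y⟫ ≤ K * F x + ε)
    (t : ℝ≥0) (x : H) : F (R.op t x) ≤ gronwallBound (F x) K ε t := by
  refine isClosed_property (p := fun x => F (R.op t x) ≤ gronwallBound (F x) K ε t)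
    R.dense_domain.denseRange_val ?_ ?_ x
  · simp_rw [gronwallBound_eq_add (F _)]
    exact isClosed_le (hF.comp (R.op t).continuous) (by fun_prop)
  rintro ⟨x, y, hxy⟩
  set u : ℝ → H := fun s => R.op s.toNNReal x with hu
  have huc : Continuous u := R.continuous_orbit_toNNReal x
  have main := le_gronwallBound_of_liminf_deriv_right_le (f := fun s => F (u s))
    (f' := fun s => RCLike.re ⟪G (u s), R.op s.toNNReal y⟫) (δ := F x) (K := K) (ε := ε)
    (a := 0) (b := t) (hF.comp huc).continuousOn ?_ (by simp [hu, op_zero_apply]) ?_ t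
    ⟨t.2, le_rfl⟩
  · simpa [hu] using main
  · intro s hs r hr
    -- F need not be differentiable: by the subgradient inequality at u(z), the slope of F ∘ u on
    -- [s, z] is at most Re⟨G(u z), slope of u⟩, and continuity of G gives the limit as z ↓ s.
    refine Eventually.frequently ?_
    have h1 := R.hasDerivWithinAt_orbit hxy hs.1
    rw [← hasDerivWithinAt_Ioi_iff_Ici, hasDerivWithinAt_iff_tendsto_slope' (by simp)] at h1
    have h2 : Tendsto (fun z => RCLike.re ⟪G (u z), slope u s z⟫) (𝓝[>] s)
        (𝓝 (RCLike.re ⟪G (u s), R.op s.toNNReal y⟫)) := by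
      refine (RCLike.continuous_re.tendsto _).comp (Tendsto.inner ?_ h1)
      exact ((hG.comp huc).tendsto s).mono_left nhdsWithin_le_nhds
    filter_upwards [h2.eventually (gt_mem_nhds hr), self_mem_nhdsWithin] with z hz hsz
    refine lt_of_le_of_lt ?_ hz
    have hpos : 0 < (z - s)⁻¹ := inv_pos.2 (sub_pos.2 hsz)
    rw [slope_def_module, RCLike.real_smul_eq_coe_smul (K := 𝕜), inner_smul_right,
      RCLike.re_ofReal_mul]
    exact mul_le_mul_of_nonneg_left (hFG _ _) hpos.le
  · intro s hs
    exact hgen _ _ (R.op_mem_generatorGraph hxy _)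

theorem norm_op_le_of_dissipative (R : C0Semigroup 𝕜 H)
    (hgen : ∀ x y, (x, y) ∈ R.generatorGraph → RCLike.re ⟪x, y⟫ ≤ 0) (t : ℝ≥0) (x : H) :
    ‖R.op t x‖ ≤ ‖x‖ := by
  have h := R.le_gronwallBound_of_convex (F := fun x => ‖x‖ ^ 2) (G := fun x => (2 : 𝕜) • x)
    (by fun_prop) (by fun_prop) (fun a b => ?_) (K := 0) (ε := 0) (fun x y hxy => ?_) t x
  · simp only [gronwallBound_K0, zero_mul, add_zero] at h
    exact le_of_sq_le_sq h (norm_nonneg _)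
  · have h1 : ‖a - (a - b)‖ ^ 2 = _ := norm_sub_sq (𝕜 := 𝕜) a (a - b)
    rw [sub_sub_cancel] at h1
    rw [inner_smul_left, map_ofNat, ← RCLike.ofReal_ofNat, RCLike.re_ofReal_mul]
    nlinarith [sq_nonneg ‖a - b‖]
  · have := hgen x y hxy
    rw [inner_smul_left, map_ofNat, ← RCLike.ofReal_ofNat, RCLike.re_ofReal_mul]
    linarith

end Lyapunov

end C0Semigroup

/-! ### Bounded perturbations of contraction semigroups -/

namespace C0Semigroup

open scoped BoundedContinuousFunction

section Rescale

variable {𝕜 X : Type*} [RCLike 𝕜] [NormedAddCommGroup X] [NormedSpace 𝕜 X]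

/-- The rescaled semigroup `t ↦ e^{ct} R(t)`. -/
noncomputable def rescale (R : C0Semigroup 𝕜 X) (c : ℝ) : C0Semigroup 𝕜 X where
  op t := ((Real.exp (c * t) : ℝ) : 𝕜) • R.op t
  op_zero := by simp [R.op_zero]
  op_add s t := by
    ext x
    simp only [_root_.smul_apply, ContinuousLinearMap.comp_apply, op_add_apply,
      map_smul, smul_smul]
    congr 1
    rw [← RCLike.ofReal_mul, ← Real.exp_add]
    congr 2
    push_cast
    ring
  continuous_orbit x := by
    have := R.continuous_orbit x
    simp only [_root_.smul_apply]
    fun_prop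

theorem rescale_op (R : C0Semigroup 𝕜 X) (c : ℝ) (t : ℝ≥0) (x : X) :
    (R.rescale c).op t x = ((Real.exp (c * t) : ℝ) : 𝕜) • R.op t x := rfl

variable [NormedSpace ℝ X] [IsScalarTower ℝ 𝕜 X]

theorem mem_generatorGraph_rescale_of_mem (R : C0Semigroup 𝕜 X) (c : ℝ) {x y : X}
    (h : (x, y) ∈ R.generatorGraph) :
    (x, y + c • x) ∈ (R.rescale c).generatorGraph := by
  rw [mem_generatorGraph_iff] at h ⊢
  have h1 : HasDerivWithinAt (fun s : ℝ => Real.exp (c * s)) c (Ici 0) 0 := by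
    have := ((hasDerivAt_id (0 : ℝ)).const_mul c).exp
    simpa using this.hasDerivWithinAt
  have h2 := h1.smul h
  simp only [mul_zero, Real.exp_zero, one_smul, Real.toNNReal_zero, op_zero_apply] at h2
  refine h2.congr (fun s hs => ?_) ?_
  · rw [rescale_op, Real.coe_toNNReal s hs, ← RCLike.real_smul_eq_coe_smul]; rfl
  · simp [op_zero_apply]

theorem mem_generatorGraph_rescale_iff (R : C0Semigroup 𝕜 X) (c : ℝ) (x y : X) :
    (x, y) ∈ (R.rescale c).generatorGraph ↔ (x, y - c • x) ∈ R.generatorGraph := by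
  constructor
  · intro h
    have h1 := (R.rescale c).mem_generatorGraph_rescale_of_mem (-c) h
    have h2 : ((R.rescale c).rescale (-c)).op = R.op := by
      ext t x
      rw [rescale_op, rescale_op, smul_smul, ← RCLike.ofReal_mul, ← Real.exp_add]
      simp
    have h3 : ((R.rescale c).rescale (-c)).generatorGraph = R.generatorGraph := by
      unfold generatorGraph; rw [h2]
    rw [h3] at h1
    simpa [sub_eq_add_neg] using h1
  · intro h
    simpa using R.mem_generatorGraph_rescale_of_mem c h

end Rescale

section BoundedPerturbation

variable {𝕜 X : Type*} [RCLike 𝕜] [NormedAddCommGroup X] [NormedSpace 𝕜 X]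

theorem continuous_op_uncurry (R : C0Semigroup 𝕜 X) (hR : ∀ t x, ‖R.op t x‖ ≤ ‖x‖) :
    Continuous fun p : ℝ≥0 × X => R.op p.1 p.2 := by
  refine continuous_prod_of_continuous_lipschitzWith' _ 1 (fun t => ?_) R.continuous_orbit
  exact (R.op t).lipschitz.weaken
    ((R.op t).opNorm_le_bound zero_le_one fun x => by simpa using hR t x)

/-- The integrand `U(r) B v(s - r)` of the Volterra operator. -/
def volterraKernel (U : C0Semigroup 𝕜 X) (B : X →L[𝕜] X) (v : ℝ≥0 →ᵇ X) (s r : ℝ) : X :=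
  U.op r.toNNReal (B (v (s - r).toNNReal))

theorem continuous_volterraKernel (U : C0Semigroup 𝕜 X) (hU : ∀ t x, ‖U.op t x‖ ≤ ‖x‖)
    (B : X →L[𝕜] X) (v : ℝ≥0 →ᵇ X) :
    Continuous (Function.uncurry (U.volterraKernel B v)) := by
  refine (U.continuous_op_uncurry hU).comp (Continuous.prodMk (by fun_prop) ?_)
  have := v.continuous
  fun_prop

variable [NormedSpace ℝ X]

theorem continuous_volterra (U : C0Semigroup 𝕜 X) (hU : ∀ t x, ‖U.op t x‖ ≤ ‖x‖)
    (B : X →L[𝕜] X) (v : ℝ≥0 →ᵇ X) :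
    Continuous fun s : ℝ => ∫ r in (0 : ℝ)..s, U.volterraKernel B v s r :=
  intervalIntegral.continuous_parametric_intervalIntegral_of_continuous
    (U.continuous_volterraKernel hU B v) continuous_id

theorem norm_volterra_le (U : C0Semigroup 𝕜 X) {l : ℝ} (hl : 0 < l)
    (hU : ∀ t x, ‖U.op t x‖ ≤ Real.exp (-(l * t)) * ‖x‖) (B : X →L[𝕜] X) (v : ℝ≥0 →ᵇ X)
    {s : ℝ} (hs : 0 ≤ s) :
    ‖∫ r in (0 : ℝ)..s, U.volterraKernel B v s r‖ ≤ ‖B‖ / l * ‖v‖ := by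
  have h1 : ∀ r, HasDerivAt (fun r => -(Real.exp (-(l * r)) * (‖B‖ / l * ‖v‖)))
      (Real.exp (-(l * r)) * (‖B‖ * ‖v‖)) r := by
    intro r
    have := ((((hasDerivAt_id r).const_mul l).neg.exp).mul_const (‖B‖ / l * ‖v‖)).neg
    refine this.congr_deriv ?_
    simp only [Pi.neg_apply, id]
    field_simp
  have h2 : Continuous fun r => Real.exp (-(l * r)) * (‖B‖ * ‖v‖) := by fun_prop
  refine (intervalIntegral.norm_integral_le_of_norm_le hs (Eventually.of_forall fun r hr => ?_)
    (h2.intervalIntegrable _ _)).trans ?_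
  · refine (hU _ _).trans ?_
    rw [Real.coe_toNNReal r hr.1.le]
    gcongr
    exact (B.le_opNorm _).trans (by gcongr; exact v.norm_coe_le_norm _)
  · rw [intervalIntegral.integral_eq_sub_of_hasDerivAt (fun r _ => h1 r) (h2.intervalIntegrable _ _)]
    have : 0 ≤ Real.exp (-(l * s)) * (‖B‖ / l * ‖v‖) := by positivity
    simp only [mul_zero, neg_zero, Real.exp_zero, one_mul]
    linarith

variable [CompleteSpace X]

/-- The substitution r ↦ s·r writes the integral as s·H(s) with H continuous, so its derivative at 0
is H(0). -/
theorem hasDerivAt_volterra (U : C0Semigroup 𝕜 X) (hU : ∀ t x, ‖U.op t x‖ ≤ ‖x‖)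
    (B : X →L[𝕜] X) (v : ℝ≥0 →ᵇ X) :
    HasDerivAt (fun s : ℝ => ∫ r in (0 : ℝ)..s, U.volterraKernel B v s r) (B (v 0)) 0 := by
  have hc := U.continuous_volterraKernel hU B v
  set H : ℝ → X := fun s => ∫ r in (0 : ℝ)..1, U.volterraKernel B v s (s * r) with hH
  have hHc : Continuous H := by
    refine intervalIntegral.continuous_parametric_intervalIntegral_of_continuous
      (f := fun s r => U.volterraKernel B v s (s * r)) ?_ continuous_const
    exact hc.comp (Continuous.prodMk continuous_fst (by fun_prop))
  have hH0 : H 0 = B (v 0) := by simp [hH, volterraKernel, op_zero_apply]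
  have e : ∀ s : ℝ, (∫ r in (0 : ℝ)..s, U.volterraKernel B v s r) = s • H s := by
    intro s
    simp only [hH]
    rw [intervalIntegral.smul_integral_comp_mul_left]
    simp
  rw [← hH0, hasDerivAt_iff_tendsto_slope]
  refine ((hHc.tendsto 0).mono_left nhdsWithin_le_nhds).congr' ?_
  filter_upwards [self_mem_nhdsWithin] with s hs
  have hs : s ≠ 0 := hs
  simp only [e, slope_def_module]
  simp [smul_smul, hs]

variable [IsScalarTower ℝ 𝕜 X]

/-- The Volterra operator `(K v)(t) = ∫₀ᵗ U(r) B v(t - r) dr` on bounded continuous functions. -/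
noncomputable def volterra (U : C0Semigroup 𝕜 X) {l : ℝ} (hl : 0 < l)
    (hU : ∀ t x, ‖U.op t x‖ ≤ Real.exp (-(l * t)) * ‖x‖) (hU' : ∀ t x, ‖U.op t x‖ ≤ ‖x‖)
    (B : X →L[𝕜] X) : (ℝ≥0 →ᵇ X) →L[𝕜] (ℝ≥0 →ᵇ X) :=
  LinearMap.mkContinuous
    { toFun := fun v => BoundedContinuousFunction.ofNormedAddCommGroup
        (fun t : ℝ≥0 => ∫ r in (0 : ℝ)..t, U.volterraKernel B v t r)
        ((U.continuous_volterra hU' B v).comp NNReal.continuous_coe) (‖B‖ / l * ‖v‖)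
        (fun t => U.norm_volterra_le hl hU B v t.2)
      map_add' := fun v w => by
        ext t
        have hi : ∀ v : ℝ≥0 →ᵇ X, IntervalIntegrable (U.volterraKernel B v t) volume 0 t := fun v =>
          ((U.continuous_volterraKernel hU' B v).comp
            (Continuous.prodMk_right (t : ℝ))).intervalIntegrable _ _
        simp only [BoundedContinuousFunction.coe_ofNormedAddCommGroup,
          BoundedContinuousFunction.coe_add, Pi.add_apply]
        rw [← intervalIntegral.integral_add (hi v) (hi w)]
        simp [volterraKernel]
      map_smul' := fun c v => by
        ext t
        simp only [BoundedContinuousFunction.coe_ofNormedAddCommGroup, RingHom.id_apply,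
          BoundedContinuousFunction.coe_smul]
        rw [← intervalIntegral.integral_smul]
        simp [volterraKernel] }
    (‖B‖ / l) (fun v => (BoundedContinuousFunction.norm_le (by positivity)).2
      fun t => U.norm_volterra_le hl hU B v t.2)

/-- The orbit map `x ↦ (t ↦ U(t) x)` into the bounded continuous functions. -/
noncomputable def orbitMap (U : C0Semigroup 𝕜 X) (hU : ∀ t x, ‖U.op t x‖ ≤ ‖x‖) :
    X →L[𝕜] (ℝ≥0 →ᵇ X) :=
  LinearMap.mkContinuous
    { toFun := fun x => BoundedContinuousFunction.ofNormedAddCommGroup (fun t => U.op t x)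
        (U.continuous_orbit x) ‖x‖ (fun t => hU t x)
      map_add' := fun x y => by ext t; simp
      map_smul' := fun c x => by ext t; simp }
    1 (fun x => by
      rw [one_mul]
      exact (BoundedContinuousFunction.norm_le (norm_nonneg x)).2 fun t => hU t x)

/-- Orbits of the perturbed semigroup are the solutions of v(t) = U(t)x + ∫₀ᵗ U(r) B v(t−r) dr.
Decay at a rate l > ‖B‖ makes the Volterra operator a strict contraction on bounded continuous
functions on all of [0, ∞), so a single Neumann series solves the equation for all times. Uniqueness
yields the semigroup law, and the derivative Bx of the integral term at 0 identifies the generator.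
-/
theorem exists_perturbation_of_decay (U : C0Semigroup 𝕜 X) {l : ℝ} (hl : 0 < l)
    (hU : ∀ t x, ‖U.op t x‖ ≤ Real.exp (-(l * t)) * ‖x‖) (B : X →L[𝕜] X) (hB : ‖B‖ < l) :
    ∃ S : C0Semigroup 𝕜 X, ∀ x y, (x, y) ∈ S.generatorGraph ↔ (x, y - B x) ∈ U.generatorGraph := by
  have hU' : ∀ t x, ‖U.op t x‖ ≤ ‖x‖ := fun t x => (hU t x).trans <| by
    refine mul_le_of_le_one_left (norm_nonneg _) (Real.exp_le_one_iff.2 ?_)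
    have := t.2
    simp only [Left.neg_nonpos_iff]; positivity
  set K := U.volterra hl hU hU' B
  set J := U.orbitMap hU'
  have hKn : ‖K‖ < 1 :=
    (K.opNorm_le_bound (by positivity) fun v => (BoundedContinuousFunction.norm_le (by positivity)).2
      fun t => U.norm_volterra_le hl hU B v t.2).trans_lt ((div_lt_one hl).2 hB)
  set u := Units.oneSub K hKn
  set sol : X →L[𝕜] (ℝ≥0 →ᵇ X) := (↑u⁻¹ : (ℝ≥0 →ᵇ X) →L[𝕜] (ℝ≥0 →ᵇ X)).comp J
  have sol_eq : ∀ x, sol x = J x + K (sol x) := by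
    intro x
    have h : (↑u * ↑u⁻¹ : (ℝ≥0 →ᵇ X) →L[𝕜] (ℝ≥0 →ᵇ X)) (J x) = J x := by rw [u.mul_inv]; rfl
    have h2 : sol x - K (sol x) = J x := h
    rw [← h2]; abel
  have sol_unique : ∀ x v, v = J x + K v → v = sol x := by
    intro x v hv
    have h : (↑u⁻¹ * ↑u : (ℝ≥0 →ᵇ X) →L[𝕜] (ℝ≥0 →ᵇ X)) v = v := by rw [u.inv_mul]; rfl
    have h2 : (↑u : (ℝ≥0 →ᵇ X) →L[𝕜] (ℝ≥0 →ᵇ X)) v = J x := by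
      show v - K v = J x
      exact sub_eq_of_eq_add hv
    rw [← h]
    show (↑u⁻¹ : (ℝ≥0 →ᵇ X) →L[𝕜] (ℝ≥0 →ᵇ X)) ((↑u : (ℝ≥0 →ᵇ X) →L[𝕜] (ℝ≥0 →ᵇ X)) v) = _
    rw [h2]; rfl
  have sol_apply : ∀ x t, sol x t = U.op t x + ∫ r in (0 : ℝ)..t, U.volterraKernel B (sol x) t r := by
    intro x t
    conv_lhs => rw [sol_eq x]
    rfl
  have hcont : ∀ v s, Continuous (U.volterraKernel B v s) := fun v s =>
    (U.continuous_volterraKernel hU' B v).comp (Continuous.prodMk_right s)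
  have sol_zero : ∀ x, sol x 0 = x := fun x => by rw [sol_apply]; simp [op_zero_apply]
  -- The shifted solution solves the equation with initial value `sol x t`: splitting ∫₀^{s+t} at s,
  -- the tail is U(s) applied to the integral term of `sol x t`.
  have sol_add : ∀ x s t, sol x (s + t) = sol (sol x t) s := by
    intro x s t
    set v : ℝ≥0 →ᵇ X := (sol x).compContinuous ⟨fun s => s + t, by fun_prop⟩ with hv
    suffices v = sol (sol x t) by rw [← this]; rfl
    refine sol_unique _ _ ?_
    ext s
    show sol x (s + t) = U.op s (sol x t) + ∫ r in (0 : ℝ)..s, U.volterraKernel B v s r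
    have e1 : ∫ r in (0 : ℝ)..s, U.volterraKernel B v s r
        = ∫ r in (0 : ℝ)..s, U.volterraKernel B (sol x) (s + t) r := by
      refine intervalIntegral.integral_congr fun r hr => ?_
      rw [uIcc_of_le s.coe_nonneg] at hr
      have : ((s : ℝ) - r).toNNReal + t = (s + t - r : ℝ).toNNReal := by
        rw [add_sub_right_comm, Real.toNNReal_add (sub_nonneg.2 hr.2) t.coe_nonneg, Real.toNNReal_coe]
      simp [volterraKernel, hv, this]
    have e2 : U.op s (∫ r in (0 : ℝ)..t, U.volterraKernel B (sol x) t r)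
        = ∫ r in (s : ℝ)..(s + t : ℝ), U.volterraKernel B (sol x) (s + t) r := by
      rw [← ContinuousLinearMap.intervalIntegral_comp_comm _ ((hcont _ _).intervalIntegrable _ _)]
      have := intervalIntegral.integral_comp_add_left
        (a := 0) (b := t) (fun r => U.volterraKernel B (sol x) (s + t) r) (s : ℝ)
      rw [add_zero] at this
      rw [← this]
      refine intervalIntegral.integral_congr fun r hr => ?_
      rw [uIcc_of_le t.coe_nonneg] at hr
      simp only [volterraKernel]
      rw [← op_add_apply, Real.toNNReal_add s.coe_nonneg hr.1, Real.toNNReal_coe]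
      congr 4
      ring
    rw [sol_apply x (s + t), sol_apply x t, map_add, e2, e1, op_add_apply, add_assoc]
    congr 1
    rw [add_comm (∫ r in (s : ℝ)..(s + t : ℝ), _), NNReal.coe_add,
      intervalIntegral.integral_add_adjacent_intervals
      ((hcont _ _).intervalIntegrable _ _) ((hcont _ _).intervalIntegrable _ _)]
  refine ⟨⟨fun t => (BoundedContinuousFunction.evalCLM 𝕜 t).comp sol, ?_, ?_, ?_⟩, ?_⟩
  · ext x; exact sol_zero x
  · intro s t; ext x; exact sol_add x s t
  · intro x; exact (sol x).continuous
  · intro x y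
    have hd := (U.hasDerivAt_volterra hU' B (sol x)).hasDerivWithinAt (s := Ici 0)
    rw [sol_zero] at hd
    have e : ∀ s ∈ Ici (0 : ℝ), sol x s.toNNReal
        = U.op s.toNNReal x + ∫ r in (0 : ℝ)..s, U.volterraKernel B (sol x) s r := by
      intro s hs
      rw [sol_apply, Real.coe_toNNReal s hs]
    rw [mem_generatorGraph_iff, mem_generatorGraph_iff]
    constructor
    · intro h
      have h : HasDerivWithinAt (fun s : ℝ => sol x s.toNNReal) y (Ici 0) 0 := h
      refine (h.sub hd).congr (fun s hs => ?_) ?_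
      · simp [e s hs]
      · simp [op_zero_apply, sol_zero]
    · intro h
      show HasDerivWithinAt (fun s : ℝ => sol x s.toNNReal) y (Ici 0) 0
      refine ((h.add hd).congr (fun s hs => ?_) ?_).congr_deriv (sub_add_cancel _ _)
      · simp [e s hs]
      · simp [op_zero_apply, sol_zero]

/-- Bounded perturbation theorem for contraction semigroups. -/
theorem exists_perturbation (T : C0Semigroup 𝕜 X) (hT : ∀ t x, ‖T.op t x‖ ≤ ‖x‖)
    (B : X →L[𝕜] X) :
    ∃ S : C0Semigroup 𝕜 X, ∀ x y, (x, y) ∈ S.generatorGraph ↔ (x, y - B x) ∈ T.generatorGraph := by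
  -- Rescaling by exp(−lt) gives a contraction semigroup a decay rate exceeding ‖B‖; scaling back by
  -- exp(lt) undoes the shift of the generator.
  set l := ‖B‖ + 1
  obtain ⟨S, hS⟩ := (T.rescale (-l)).exists_perturbation_of_decay (l := l) (by positivity)
    (fun t x => by
      rw [rescale_op, norm_smul, RCLike.norm_ofReal, Real.abs_exp, neg_mul]
      exact mul_le_mul_of_nonneg_left (hT t x) (Real.exp_nonneg _)) B (lt_add_one _)
  refine ⟨S.rescale l, fun x y => ?_⟩
  rw [mem_generatorGraph_rescale_iff, hS, mem_generatorGraph_rescale_iff]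
  rw [neg_smul, sub_neg_eq_add, sub_right_comm, sub_add_cancel]

end BoundedPerturbation

end C0Semigroup

/-! ### Multiplication operators on L_2 -/

section Multiplication

variable {𝕜 Ω : Type*} [RCLike 𝕜] [MeasurableSpace Ω] {μ : Measure Ω}

/-- Multiplication by a bounded function, as an operator on `L_2`. -/
noncomputable def mulOp {W : Ω → ℝ} (hW : MemLp (fun x => (W x : 𝕜)) ∞ μ) :
    Lp 𝕜 2 μ →L[𝕜] Lp 𝕜 2 μ :=
  (ContinuousLinearMap.mul 𝕜 𝕜).holderL μ ∞ 2 2 (hW.toLp _)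

theorem coeFn_mulOp {W : Ω → ℝ} (hW : MemLp (fun x => (W x : 𝕜)) ∞ μ) (u : Lp 𝕜 2 μ) :
    mulOp hW u =ᵐ[μ] fun x => (W x : 𝕜) * u x := by
  have h := (ContinuousLinearMap.mul 𝕜 𝕜).coeFn_holder (r := 2) (hW.toLp _) u
  filter_upwards [h, hW.coeFn_toLp] with x hx hx'
  rw [← hx']
  exact hx

theorem memLp_top_ofReal {W : Ω → ℝ} (hW : AEMeasurable W μ) {C : ℝ}
    (hC : ∀ᵐ x ∂μ, |W x| ≤ C) : MemLp (fun x => (W x : 𝕜)) ∞ μ :=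
  memLp_top_of_bound (RCLike.measurable_ofReal.comp_aemeasurable hW).aestronglyMeasurable C
    (by simpa using hC)

end Multiplication

/-! ### The Dirichlet Laplacian: weak formulation, energy identity, Hardy type bound -/

section TestFunctions

variable {𝕜 : Type*} [RCLike 𝕜]

local notation "⟪" x ", " y "⟫" => inner 𝕜 x y

namespace IsHalfLineTest

variable {φ ψ : ℝ → 𝕜}

theorem memLp (hφ : IsHalfLineTest φ) (p : ℝ≥0∞) : MemLp φ p halfLineMeasure :=
  hφ.1.continuous.memLp_of_hasCompactSupport hφ.2.1

theorem deriv (hφ : IsHalfLineTest φ) : IsHalfLineTest (deriv φ) :=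
  ⟨(contDiff_infty_iff_deriv.1 hφ.1).2, hφ.2.1.deriv, tsupport_deriv_subset.trans hφ.2.2⟩

theorem star (hφ : IsHalfLineTest φ) : IsHalfLineTest (fun x => Star.star (φ x)) := by
  refine ⟨(RCLike.conjCLE (K := 𝕜)).contDiff.comp hφ.1, hφ.2.1.comp_left (star_zero 𝕜), ?_⟩
  exact (tsupport_comp_subset (g := (Star.star : 𝕜 → 𝕜)) (star_zero 𝕜) φ).trans hφ.2.2

theorem mul_left (hφ : IsHalfLineTest φ) (hψ : ContDiff ℝ ∞ ψ) :
    IsHalfLineTest (fun x => ψ x * φ x) :=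
  ⟨hψ.mul hφ.1, hφ.2.1.mul_left, (tsupport_mul_subset_right).trans hφ.2.2⟩

theorem eq_zero (hφ : IsHalfLineTest φ) {x : ℝ} (hx : x ∉ Ioi 0) : φ x = 0 :=
  image_eq_zero_of_notMem_tsupport fun h => hx (hφ.2.2 h)

theorem integrable (hφ : IsHalfLineTest φ) : Integrable φ :=
  hφ.1.continuous.integrable_of_hasCompactSupport hφ.2.1

theorem hasDerivAt (hφ : IsHalfLineTest φ) (x : ℝ) : HasDerivAt φ (_root_.deriv φ x) x :=
  (hφ.1.differentiable (by simp) x).hasDerivAt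

theorem integral_deriv (hφ : IsHalfLineTest φ) : ∫ x in Ioi (0 : ℝ), _root_.deriv φ x = 0 := by
  rw [setIntegral_eq_integral_of_forall_compl_eq_zero fun x hx => hφ.deriv.eq_zero hx]
  exact integral_eq_zero_of_hasDerivAt_of_integrable hφ.hasDerivAt hφ.deriv.integrable
    hφ.integrable

/-- The class of a test function in `L_2(0, ∞)`. -/
noncomputable def toLp (hφ : IsHalfLineTest φ) : HalfLineL2 𝕜 := (hφ.memLp 2).toLp φ

theorem coeFn_toLp (hφ : IsHalfLineTest φ) : hφ.toLp =ᵐ[halfLineMeasure] φ :=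
  (hφ.memLp 2).coeFn_toLp

theorem inner_toLp (hφ : IsHalfLineTest φ) (u : HalfLineL2 𝕜) :
    ⟪hφ.toLp, u⟫ = ∫ x in Ioi (0 : ℝ), u x * Star.star (φ x) := by
  rw [L2.inner_def]
  refine integral_congr_ae ?_
  filter_upwards [hφ.coeFn_toLp] with x hx
  rw [hx, RCLike.inner_apply]; rfl

theorem inner_deriv_toLp (hφ : IsHalfLineTest φ) (hψ : IsHalfLineTest ψ) :
    ⟪hψ.deriv.toLp, hφ.toLp⟫ = -⟪hψ.toLp, hφ.deriv.toLp⟫ := by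
  have hp := hφ.mul_left hψ.star.1
  have h0 := hp.integral_deriv
  have hd : ∀ x, _root_.deriv (fun x => Star.star (ψ x) * φ x) x
      = φ x * Star.star (_root_.deriv ψ x) + _root_.deriv φ x * Star.star (ψ x) := by
    intro x
    rw [((hψ.hasDerivAt x).star.fun_mul (hφ.hasDerivAt x)).deriv]
    ring
  rw [integral_congr_ae (Eventually.of_forall hd), integral_add] at h0
  · rw [inner_toLp, inner_toLp, ← sub_eq_zero, sub_neg_eq_add, ← h0]
    congr 1 <;> refine integral_congr_ae ?_
    · filter_upwards [hφ.coeFn_toLp] with x hx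
      rw [hx]
    · filter_upwards [hφ.deriv.coeFn_toLp] with x hx
      rw [hx]
  · exact (hψ.deriv.star.mul_left hφ.1).integrable.integrableOn
  · exact (hψ.star.mul_left hφ.deriv.1).integrable.integrableOn

/-- Since φ(0) = 0, φ(x) is the inner product of φ' with the indicator of (0, x], whose squared norm
is x; then Cauchy–Schwarz. -/
theorem norm_sq_le (hφ : IsHalfLineTest φ) {x : ℝ} (hx : 0 < x) :
    ‖φ x‖ ^ 2 ≤ x * ‖hφ.deriv.toLp‖ ^ 2 := by
  have hm : halfLineMeasure (Ioc 0 x) = ENNReal.ofReal x := by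
    rw [Measure.restrict_apply measurableSet_Ioc,
      inter_eq_left.2 (Ioc_subset_Ioi_self), Real.volume_Ioc, sub_zero]
  have hne : halfLineMeasure (Ioc 0 x) ≠ ⊤ := by rw [hm]; exact ENNReal.ofReal_ne_top
  have h1 := L2.inner_indicatorConstLp_one (𝕜 := 𝕜) measurableSet_Ioc hne hφ.deriv.toLp
  have h2 : ∫ y in Ioc 0 x, hφ.deriv.toLp y ∂halfLineMeasure = φ x := by
    rw [setIntegral_congr_ae (g := _root_.deriv φ) measurableSet_Ioc
      (by filter_upwards [hφ.deriv.coeFn_toLp] with y hy _ using hy),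
      Measure.restrict_restrict measurableSet_Ioc, inter_eq_left.2 (Ioc_subset_Ioi_self),
      ← intervalIntegral.integral_of_le hx.le,
      intervalIntegral.integral_eq_sub_of_hasDerivAt (fun y _ => hφ.hasDerivAt y)
        (hφ.deriv.1.continuous.intervalIntegrable _ _), hφ.eq_zero (x := 0) (by simp), sub_zero]
  have h3 : ‖indicatorConstLp 2 measurableSet_Ioc hne (1 : 𝕜)‖ ^ 2 = x := by
    rw [norm_indicatorConstLp (by simp) (by simp), Measure.real, hm, ENNReal.toReal_ofReal hx.le,
      norm_one, one_mul, ← Real.rpow_natCast, ← Real.rpow_mul hx.le]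
    norm_num
  have h4 := norm_inner_le_norm (𝕜 := 𝕜) (indicatorConstLp 2 measurableSet_Ioc hne (1 : 𝕜))
    hφ.deriv.toLp
  rw [h1, h2] at h4
  calc ‖φ x‖ ^ 2 ≤ (‖indicatorConstLp 2 measurableSet_Ioc hne (1 : 𝕜)‖ * ‖hφ.deriv.toLp‖) ^ 2 := by
        gcongr
    _ = _ := by rw [mul_pow, h3]

end IsHalfLineTest

/-- Elements of the graph of the Dirichlet Laplacian: approximation by test functions and the
weak formulation. -/
theorem exists_weak_derivative {u v : HalfLineL2 𝕜} (h : (u, v) ∈ dirichletLaplacianGraph 𝕜) :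
    ∃ (w : HalfLineL2 𝕜) (φ : ℕ → ℝ → 𝕜) (hφ : ∀ n, IsHalfLineTest (φ n)),
      Tendsto (fun n => (hφ n).toLp) atTop (𝓝 u) ∧
      Tendsto (fun n => (hφ n).deriv.toLp) atTop (𝓝 w) ∧
      ∀ (ψ : ℝ → 𝕜) (hψ : IsHalfLineTest ψ), ⟪hψ.deriv.toLp, w⟫ = -⟪hψ.toLp, v⟫ := by
  obtain ⟨⟨w, φ, hφ, h1, h2⟩, h3⟩ := h
  have t1 : Tendsto (fun n => (hφ n).toLp) atTop (𝓝 u) := by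
    rw [Lp.tendsto_Lp_iff_tendsto_eLpNorm']
    refine h1.congr fun n => eLpNorm_congr_ae ?_
    filter_upwards [(hφ n).coeFn_toLp] with x hx
    simp [hx]
  have t2 : Tendsto (fun n => (hφ n).deriv.toLp) atTop (𝓝 w) := by
    rw [Lp.tendsto_Lp_iff_tendsto_eLpNorm']
    refine h2.congr fun n => eLpNorm_congr_ae ?_
    filter_upwards [(hφ n).deriv.coeFn_toLp] with x hx
    simp [hx]
  refine ⟨w, φ, hφ, t1, t2, fun ψ hψ => ?_⟩
  -- The distributional identity is bilinear while the inner product conjugates its first argument,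
  -- so the identity is tested with the conjugate of ψ.
  have e1 : ⟪hψ.deriv.deriv.toLp, u⟫ = ⟪hψ.toLp, v⟫ := by
    have := h3 _ hψ.star
    rw [IsHalfLineTest.inner_toLp, IsHalfLineTest.inner_toLp, ← this]
    congr 1
    ext x
    congr 1
    have : deriv (fun y => star (ψ y)) = fun y => star (deriv ψ y) := by ext y; rw [deriv.star]
    rw [this, deriv.star]
  have e2 : ⟪hψ.deriv.deriv.toLp, u⟫ = -⟪hψ.deriv.toLp, w⟫ := by
    refine tendsto_nhds_unique (tendsto_const_nhds.inner t1) ?_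
    refine ((tendsto_const_nhds.inner t2).neg).congr fun n => ?_
    rw [(hφ n).inner_deriv_toLp hψ.deriv]
  rw [← e1, e2, neg_neg]

/-- The energy identity `⟨u, u''⟩ = -‖u'‖²` and the Hardy type bound `|u(x)|² ≤ x ‖u'‖²`. -/
theorem exists_energy {u v : HalfLineL2 𝕜} (h : (u, v) ∈ dirichletLaplacianGraph 𝕜) :
    ∃ e : ℝ, 0 ≤ e ∧ RCLike.re ⟪u, v⟫ = -e ^ 2 ∧
      ∀ᵐ x ∂halfLineMeasure, ‖u x‖ ^ 2 ≤ x * e ^ 2 := by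
  obtain ⟨w, φ, hφ, t1, t2, hw⟩ := exists_weak_derivative h
  refine ⟨‖w‖, norm_nonneg _, ?_, ?_⟩
  -- The weak formulation is tested with the approximants φ n themselves, and n → ∞.
  · have : ⟪w, w⟫ = -⟪u, v⟫ :=
      tendsto_nhds_unique (t2.inner tendsto_const_nhds)
        (((t1.inner tendsto_const_nhds).neg).congr fun n => (hw _ (hφ n)).symm)
    rw [← inner_self_eq_norm_sq (𝕜 := 𝕜), this]
    simp
  -- An a.e. convergent subsequence carries the pointwise bound from the test functions to u.
  · have hm := tendstoInMeasure_of_tendsto_eLpNorm (p := 2) (by simp)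
      (fun n => Lp.aestronglyMeasurable _) (Lp.aestronglyMeasurable u)
      ((Lp.tendsto_Lp_iff_tendsto_eLpNorm' _ _).1 t1)
    obtain ⟨ns, hns, hae⟩ := hm.exists_seq_tendsto_ae
    have hall : ∀ᵐ x ∂halfLineMeasure, ∀ n, (hφ n).toLp x = φ n x :=
      ae_all_iff.2 fun n => (hφ n).coeFn_toLp
    filter_upwards [hae, hall, ae_restrict_mem measurableSet_Ioi] with x h1 h2 hx
    have h3 : Tendsto (fun n => x * ‖(hφ (ns n)).deriv.toLp‖ ^ 2) atTop (𝓝 (x * ‖w‖ ^ 2)) :=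
      (((t2.comp hns.tendsto_atTop).norm).pow 2).const_mul x
    refine le_of_tendsto_of_tendsto' (h1.norm.pow 2) h3 fun n => ?_
    rw [h2]
    exact (hφ _).norm_sq_le hx

end TestFunctions

/-! ### Form estimates and dependence of T_W on W -/

section Energy

variable {𝕜 : Type*} [RCLike 𝕜]

local notation "⟪" x ", " y "⟫" => inner 𝕜 x y

/-- `∫₀^∞ x |W(x)| dx ≤ α`. -/
def FirstMomentLE (W : ℝ → ℝ) (α : ℝ) : Prop :=
  ∫⁻ x in Ioi (0 : ℝ), ENNReal.ofReal (x * |W x|) ≤ ENNReal.ofReal α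

theorem FirstMomentLE.mono {W : ℝ → ℝ} {α : ℝ} (h : FirstMomentLE W α) {W' : ℝ → ℝ} {α' : ℝ}
    (hα : α ≤ α') (hW : ∀ x, |W' x| ≤ |W x|) : FirstMomentLE W' α' := by
  refine le_trans ?_ (h.trans (ENNReal.ofReal_le_ofReal hα))
  refine setLIntegral_mono_ae' measurableSet_Ioi (Eventually.of_forall fun x hx => ?_)
  exact ENNReal.ofReal_le_ofReal (mul_le_mul_of_nonneg_left (hW x) (le_of_lt hx))

theorem FirstMomentLE.add {W₁ W₂ W : ℝ → ℝ} {α₁ α₂ : ℝ} (h₁ : FirstMomentLE W₁ α₁)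
    (h₂ : FirstMomentLE W₂ α₂) (hm : AEMeasurable W₁ halfLineMeasure) (hα₁ : 0 ≤ α₁) (hα₂ : 0 ≤ α₂)
    (hW : ∀ x, |W x| ≤ |W₁ x| + |W₂ x|) : FirstMomentLE W (α₁ + α₂) := by
  unfold FirstMomentLE at *
  rw [ENNReal.ofReal_add hα₁ hα₂]
  refine le_trans ?_ (add_le_add h₁ h₂)
  rw [← lintegral_add_left' (by fun_prop)]
  refine setLIntegral_mono_ae' measurableSet_Ioi (Eventually.of_forall fun x hx => ?_)
  have hx : (0 : ℝ) ≤ x := le_of_lt hx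
  rw [← ENNReal.ofReal_add (by positivity) (by positivity), ← mul_add]
  exact ENNReal.ofReal_le_ofReal (mul_le_mul_of_nonneg_left (hW x) hx)

theorem norm_setIntegral_le_of_firstMoment {f : ℝ → 𝕜} {W₁ W₂ : ℝ → ℝ} {α₁ α₂ C₁ C₂ : ℝ}
    (h₁ : FirstMomentLE W₁ α₁) (h₂ : FirstMomentLE W₂ α₂)
    (hm : AEMeasurable W₁ halfLineMeasure) (hα₁ : 0 ≤ α₁) (hα₂ : 0 ≤ α₂)
    (hC₁ : 0 ≤ C₁) (hC₂ : 0 ≤ C₂)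
    (hf : ∀ᵐ x ∂halfLineMeasure, ‖f x‖ ≤ C₁ * (x * |W₁ x|) + C₂ * (x * |W₂ x|)) :
    ‖∫ x in Ioi (0 : ℝ), f x‖ ≤ C₁ * α₁ + C₂ * α₂ := by
  refine (norm_integral_le_lintegral_norm _).trans ?_
  refine ENNReal.toReal_le_of_le_ofReal (by positivity) ?_
  calc ∫⁻ x in Ioi (0 : ℝ), ENNReal.ofReal ‖f x‖
      ≤ ∫⁻ x in Ioi (0 : ℝ), (ENNReal.ofReal C₁ * ENNReal.ofReal (x * |W₁ x|)
          + ENNReal.ofReal C₂ * ENNReal.ofReal (x * |W₂ x|)) := by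
        refine lintegral_mono_ae ?_
        filter_upwards [hf, ae_restrict_mem measurableSet_Ioi] with x h hx
        have hx : (0 : ℝ) ≤ x := le_of_lt hx
        rw [← ENNReal.ofReal_mul hC₁, ← ENNReal.ofReal_mul hC₂,
          ← ENNReal.ofReal_add (by positivity) (by positivity)]
        exact ENNReal.ofReal_le_ofReal h
    _ = ENNReal.ofReal C₁ * (∫⁻ x in Ioi (0 : ℝ), ENNReal.ofReal (x * |W₁ x|))
          + ENNReal.ofReal C₂ * ∫⁻ x in Ioi (0 : ℝ), ENNReal.ofReal (x * |W₂ x|) := by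
        rw [lintegral_add_left' (by fun_prop), lintegral_const_mul' _ _ ENNReal.ofReal_ne_top,
          lintegral_const_mul' _ _ ENNReal.ofReal_ne_top]
    _ ≤ ENNReal.ofReal C₁ * ENNReal.ofReal α₁ + ENNReal.ofReal C₂ * ENNReal.ofReal α₂ := by
        gcongr
        · exact h₁
        · exact h₂
    _ = ENNReal.ofReal (C₁ * α₁ + C₂ * α₂) := by
        rw [← ENNReal.ofReal_mul hC₁, ← ENNReal.ofReal_mul hC₂,
          ← ENNReal.ofReal_add (by positivity) (by positivity)]

/-- With u = u₁ − u₂, the potential terms of y₁ − y₂ are −W₁u − (W₁ − W₂)u₂. Pairing with u, the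
Laplacian gives −e² where e bounds u in the form |u(x)|² ≤ x e²; the first potential term then costs
at most αe² and the second at most ε e e₂. -/
theorem exists_energy_sub {u₁ g₁ y₁ u₂ g₂ y₂ : HalfLineL2 𝕜} {W₁ W₂ : ℝ → ℝ} {α ε e₂ : ℝ}
    (hd : (u₁ - u₂, g₁ - g₂) ∈ dirichletLaplacianGraph 𝕜)
    (hy₁ : ∀ᵐ x ∂halfLineMeasure, y₁ x = g₁ x - (W₁ x : 𝕜) * u₁ x)
    (hy₂ : ∀ᵐ x ∂halfLineMeasure, y₂ x = g₂ x - (W₂ x : 𝕜) * u₂ x)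
    (hm : AEMeasurable W₁ halfLineMeasure) (hα : FirstMomentLE W₁ α) (hα0 : 0 ≤ α)
    (hε : FirstMomentLE (fun x => W₁ x - W₂ x) ε) (hε0 : 0 ≤ ε) (he₂ : 0 ≤ e₂)
    (hu₂ : ∀ᵐ x ∂halfLineMeasure, ‖u₂ x‖ ^ 2 ≤ x * e₂ ^ 2) :
    ∃ e : ℝ, 0 ≤ e ∧ RCLike.re ⟪u₁ - u₂, y₁ - y₂⟫ ≤ -(1 - α) * e ^ 2 + ε * (e * e₂) ∧
      ∀ᵐ x ∂halfLineMeasure, ‖(u₁ - u₂) x‖ ^ 2 ≤ x * e ^ 2 := by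
  obtain ⟨e, he, h1, h2⟩ := exists_energy hd
  refine ⟨e, he, ?_, h2⟩
  set p : HalfLineL2 𝕜 := (g₁ - g₂) - (y₁ - y₂) with hp
  have e1 : ⟪u₁ - u₂, y₁ - y₂⟫ = ⟪u₁ - u₂, g₁ - g₂⟫ - ⟪u₁ - u₂, p⟫ := by
    rw [← inner_sub_right, hp, sub_sub_cancel]
  have e2 : ‖⟪u₁ - u₂, p⟫‖ ≤ e ^ 2 * α + (e * e₂) * ε := by
    rw [L2.inner_def]
    refine norm_setIntegral_le_of_firstMoment hα hε hm hα0 hε0 (by positivity) (by positivity) ?_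
    filter_upwards [h2, hu₂, hy₁, hy₂, Lp.coeFn_sub u₁ u₂, Lp.coeFn_sub g₁ g₂,
      Lp.coeFn_sub y₁ y₂, Lp.coeFn_sub (g₁ - g₂) (y₁ - y₂), ae_restrict_mem measurableSet_Ioi]
      with x b1 b2 b3 b4 b5 b6 b7 b8 hx
    have hx : (0 : ℝ) ≤ x := le_of_lt hx
    have hpx : p x = (W₁ x : 𝕜) * (u₁ - u₂) x + ((W₁ x - W₂ x : ℝ) : 𝕜) * u₂ x := by
      rw [hp, b8, Pi.sub_apply, b6, b7, b5]
      simp only [Pi.sub_apply, b3, b4, RCLike.ofReal_sub]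
      ring
    have hc : ‖(u₁ - u₂) x‖ * ‖u₂ x‖ ≤ x * (e * e₂) := by
      refine le_of_sq_le_sq ?_ (by positivity)
      calc (‖(u₁ - u₂) x‖ * ‖u₂ x‖) ^ 2 = ‖(u₁ - u₂) x‖ ^ 2 * ‖u₂ x‖ ^ 2 := mul_pow _ _ _
        _ ≤ (x * e ^ 2) * (x * e₂ ^ 2) := by gcongr
        _ = _ := by ring
    calc ‖⟪(u₁ - u₂) x, p x⟫‖ ≤ ‖(u₁ - u₂) x‖ * ‖p x‖ := norm_inner_le_norm _ _
      _ ≤ ‖(u₁ - u₂) x‖ * (|W₁ x| * ‖(u₁ - u₂) x‖ + |W₁ x - W₂ x| * ‖u₂ x‖) := by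
          gcongr
          rw [hpx]
          refine (norm_add_le _ _).trans ?_
          simp only [norm_mul, RCLike.norm_ofReal, le_refl]
      _ = |W₁ x| * ‖(u₁ - u₂) x‖ ^ 2 + |W₁ x - W₂ x| * (‖(u₁ - u₂) x‖ * ‖u₂ x‖) := by ring
      _ ≤ |W₁ x| * (x * e ^ 2) + |W₁ x - W₂ x| * (x * (e * e₂)) := by gcongr
      _ = _ := by ring
  have e3 := (abs_le.1 ((RCLike.abs_re_le_norm _).trans e2)).1
  rw [e1, map_sub, h1]
  linarith

end Energy

namespace C0Semigroup

section Comparison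

variable {𝕜 : Type*} [RCLike 𝕜] {T : C0Semigroup 𝕜 (HalfLineL2 𝕜)}

local notation "⟪" x ", " y "⟫" => inner 𝕜 x y

theorem exists_energy_of_isBoundedPerturbation (hT : T.generatorGraph = dirichletLaplacianGraph 𝕜)
    {W : ℝ → ℝ} {R : C0Semigroup 𝕜 (HalfLineL2 𝕜)} (hR : T.IsBoundedPerturbation W R)
    (hm : AEMeasurable W halfLineMeasure) {α : ℝ} (hα : FirstMomentLE W α) (hα0 : 0 ≤ α)
    {u y : HalfLineL2 𝕜} (h : (u, y) ∈ R.generatorGraph) :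
    ∃ e : ℝ, 0 ≤ e ∧ RCLike.re ⟪u, y⟫ ≤ -(1 - α) * e ^ 2 ∧
      ∀ᵐ x ∂halfLineMeasure, ‖u x‖ ^ 2 ≤ x * e ^ 2 := by
  have hg := h
  rw [hR] at hg
  obtain ⟨g, hg, hy⟩ := hg
  have h0 : ∀ᵐ x ∂halfLineMeasure, (0 : HalfLineL2 𝕜) x = 0 := Lp.coeFn_zero 𝕜 2 halfLineMeasure
  have := exists_energy_sub (u₂ := 0) (g₂ := 0) (y₂ := 0) (W₂ := W) (ε := 0) (e₂ := 0)
    (u₁ := u) (g₁ := g) (y₁ := y) (by simpa [← hT] using hg) hy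
    (by filter_upwards [h0] with x hx; rw [hx]; simp) hm hα hα0 (by simp [FirstMomentLE]) le_rfl le_rfl
    (by filter_upwards [h0] with x hx; rw [hx]; simp)
  simpa using this

/-- Norm continuity of `W ↦ T_W(t)` with respect to the first moment of `W`. -/
theorem norm_op_sub_op_le (hT : T.generatorGraph = dirichletLaplacianGraph 𝕜)
    {W₁ W₂ : ℝ → ℝ} {R₁ R₂ : C0Semigroup 𝕜 (HalfLineL2 𝕜)} (hR₁ : T.IsBoundedPerturbation W₁ R₁)
    (hR₂ : T.IsBoundedPerturbation W₂ R₂)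
    (hW₁ : MemLp (fun x => (W₁ x : 𝕜)) ∞ halfLineMeasure)
    (hm₁ : AEMeasurable W₁ halfLineMeasure) (hm₂ : AEMeasurable W₂ halfLineMeasure) {α ε : ℝ}
    (hα₁ : FirstMomentLE W₁ α) (hα₂ : FirstMomentLE W₂ α) (hα0 : 0 ≤ α) (hα1 : α < 1)
    (hε : FirstMomentLE (fun x => W₁ x - W₂ x) ε) (hε0 : 0 ≤ ε) (t : ℝ≥0) (f : HalfLineL2 𝕜) :
    ‖R₁.op t f - R₂.op t f‖ ≤ ε / (2 * (1 - α)) * ‖f‖ := by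
  refine isClosed_property (p := fun f => ‖R₁.op t f - R₂.op t f‖ ≤ ε / (2 * (1 - α)) * ‖f‖)
    R₂.dense_domain.denseRange_val (isClosed_le (by fun_prop) (by fun_prop)) ?_ f
  rintro ⟨f, y₂, hy₂⟩
  have hβ : 0 < 1 - α := sub_pos.2 hα1
  -- The Lyapunov functional is ‖u₁ − u₂‖² + k²‖u₂‖². With ε = 2(1−α)k, the bound for its derivative
  -- is the complete square −2(1−α)(e − k e₂)², so it never exceeds its initial value k²‖f‖².
  set k := ε / (2 * (1 - α)) with hk
  have hk0 : 0 ≤ k := by positivity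
  have hεk : ε = 2 * (1 - α) * k := by rw [hk]; field_simp
  -- As W₁ is bounded, the domain of the generator of R₁ is that of T, so it contains the domain
  -- element f of R₂.
  obtain ⟨y₁, hy₁⟩ : ∃ y₁, (f, y₁) ∈ R₁.generatorGraph := by
    have := hy₂
    rw [hR₂] at this
    obtain ⟨g, hg, -⟩ := this
    refine ⟨g - mulOp hW₁ f, ?_⟩
    rw [hR₁]
    refine ⟨g, hg, ?_⟩
    filter_upwards [Lp.coeFn_sub g (mulOp hW₁ f), coeFn_mulOp hW₁ f] with x h1 h2
    rw [h1, Pi.sub_apply, h2]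
  set u₁ : ℝ → HalfLineL2 𝕜 := fun s => R₁.op s.toNNReal f with hu₁
  set u₂ : ℝ → HalfLineL2 𝕜 := fun s => R₂.op s.toNNReal f with hu₂
  have hu₁c : Continuous u₁ := R₁.continuous_orbit_toNNReal f
  have hu₂c : Continuous u₂ := R₂.continuous_orbit_toNNReal f
  have main := le_gronwallBound_of_liminf_deriv_right_le
    (f := fun s => ‖u₁ s - u₂ s‖ ^ 2 + k ^ 2 * ‖u₂ s‖ ^ 2)
    (f' := fun s => 2 * RCLike.re ⟪u₁ s - u₂ s, R₁.op s.toNNReal y₁ - R₂.op s.toNNReal y₂⟫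
      + k ^ 2 * (2 * RCLike.re ⟪u₂ s, R₂.op s.toNNReal y₂⟫)) (δ := k ^ 2 * ‖f‖ ^ 2)
    (K := 0) (ε := 0) (a := 0) (b := t)
    (((hu₁c.sub hu₂c).norm.pow 2).add ((hu₂c.norm.pow 2).const_mul _)).continuousOn
    ?_ ?_ ?_ t ⟨t.2, le_rfl⟩
  · simp only [gronwallBound_K0, zero_mul, add_zero] at main
    have h1 : ‖u₁ t - u₂ t‖ ^ 2 ≤ (k * ‖f‖) ^ 2 := by
      have : 0 ≤ k ^ 2 * ‖u₂ t‖ ^ 2 := by positivity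
      rw [mul_pow]; linarith
    have h2 := le_of_sq_le_sq h1 (by positivity)
    simpa [hu₁, hu₂] using h2
  · intro s hs r hr
    have h1 := R₁.hasDerivWithinAt_orbit hy₁ hs.1
    have h2 := R₂.hasDerivWithinAt_orbit hy₂ hs.1
    have h3 := (hasDerivWithinAt_norm_sq_rclike (𝕜 := 𝕜) (h1.sub h2)).add
      ((hasDerivWithinAt_norm_sq_rclike (𝕜 := 𝕜) h2).const_mul (k ^ 2))
    exact h3.liminf_right_slope_le hr
  · simp [hu₁, hu₂, op_zero_apply]
  · intro s hs
    have h1 := R₁.op_mem_generatorGraph hy₁ s.toNNReal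
    have h2 := R₂.op_mem_generatorGraph hy₂ s.toNNReal
    obtain ⟨e₂, he₂, b1, b2⟩ :=
      exists_energy_of_isBoundedPerturbation hT hR₂ hm₂ hα₂ hα0 h2
    rw [hR₁] at h1
    rw [hR₂] at h2
    obtain ⟨g₁, hg₁, c1⟩ := h1
    obtain ⟨g₂, hg₂, c2⟩ := h2
    have hd := T.sub_mem_generatorGraph hg₁ hg₂
    rw [hT] at hd
    obtain ⟨e, he, d1, -⟩ := exists_energy_sub hd c1 c2 hm₁ hα₁ hα0 hε hε0 he₂ b2
    have hsq : 0 ≤ (1 - α) * (e - k * e₂) ^ 2 := by positivity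
    have hk2 : 0 ≤ k ^ 2 := by positivity
    have b1' := mul_le_mul_of_nonneg_left b1 hk2
    rw [hεk] at d1
    simp only [hu₁, hu₂]
    nlinarith

end Comparison

end C0Semigroup

/-! ### Existence of T_V by truncation -/

namespace C0Semigroup

/-- A sequence of semigroups that is Cauchy in operator norm, uniformly in time, converges to a
semigroup. -/
theorem exists_limit {𝕜 X : Type*} [RCLike 𝕜] [NormedAddCommGroup X] [NormedSpace 𝕜 X]
    [CompleteSpace X] (R : ℕ → C0Semigroup 𝕜 X) {δ : ℕ → ℝ} (hδ : Tendsto δ atTop (𝓝 0))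
    (hδ0 : ∀ n, 0 ≤ δ n)
    (hR : ∀ n m t f, ‖(R n).op t f - (R m).op t f‖ ≤ (δ n + δ m) * ‖f‖) :
    ∃ S : C0Semigroup 𝕜 X, ∀ t f, Tendsto (fun n => (R n).op t f) atTop (𝓝 (S.op t f)) := by
  have hn : ∀ n m t, ‖(R n).op t - (R m).op t‖ ≤ δ n + δ m := fun n m t =>
    ContinuousLinearMap.opNorm_le_bound _ (add_nonneg (hδ0 n) (hδ0 m)) fun f => hR n m t f
  have hc : ∀ t, ∃ A : X →L[𝕜] X, Tendsto (fun n => (R n).op t) atTop (𝓝 A) := by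
    refine fun t => cauchySeq_tendsto_of_complete (Metric.cauchySeq_iff.2 fun ε hε => ?_)
    obtain ⟨N, hN⟩ := eventually_atTop.1 (hδ.eventually (gt_mem_nhds (half_pos hε)))
    refine ⟨N, fun n hn' m hm' => ?_⟩
    rw [dist_eq_norm]
    have := hn n m t
    have := hN n hn'
    have := hN m hm'
    linarith
  choose A hA using hc
  have hAf : ∀ t f, Tendsto (fun n => (R n).op t f) atTop (𝓝 (A t f)) := fun t f =>
    ((ContinuousLinearMap.apply 𝕜 X f).continuous.tendsto (A t)).comp (hA t)
  refine ⟨⟨A, ?_, ?_, ?_⟩, hAf⟩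
  · refine tendsto_nhds_unique (hA 0) (tendsto_const_nhds.congr fun n => ?_)
    rw [(R n).op_zero]
  · intro s t
    have h := ((ContinuousLinearMap.compL 𝕜 X X X).continuous₂.tendsto (A s, A t)).comp
      ((hA s).prodMk_nhds (hA t))
    refine tendsto_nhds_unique (hA (s + t)) (h.congr fun n => ?_)
    exact ((R n).op_add s t).symm
  · intro f
    -- The estimate is uniform in t, so continuity of the orbits survives the limit.
    have hu : TendstoUniformly (fun n t => (R n).op t f) (fun t => A t f) atTop := by
      rw [Metric.tendstoUniformly_iff]
      intro ε hε
      have h1 : Tendsto (fun n => δ n * ‖f‖) atTop (𝓝 0) := by simpa using hδ.mul_const ‖f‖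
      filter_upwards [h1.eventually (gt_mem_nhds hε)] with n hn' t
      refine lt_of_le_of_lt ?_ hn'
      rw [dist_comm, dist_eq_norm]
      have h2 : Tendsto (fun m => (δ n + δ m) * ‖f‖) atTop (𝓝 (δ n * ‖f‖)) := by
        simpa using (hδ.const_add (δ n)).mul_const ‖f‖
      exact le_of_tendsto_of_tendsto' ((tendsto_const_nhds.sub (hAf t f)).norm) h2
        fun m => hR n m t f
    exact hu.continuous (Eventually.of_forall fun n => (R n).continuous_orbit f).frequently

section Existence

variable {𝕜 : Type*} [RCLike 𝕜] {T : C0Semigroup 𝕜 (HalfLineL2 𝕜)}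

theorem norm_op_le_of_dirichletLaplacian (hT : T.generatorGraph = dirichletLaplacianGraph 𝕜)
    (t : ℝ≥0) (f : HalfLineL2 𝕜) : ‖T.op t f‖ ≤ ‖f‖ := by
  refine T.norm_op_le_of_dissipative (fun x y hxy => ?_) t f
  rw [hT] at hxy
  obtain ⟨e, -, he, -⟩ := exists_energy hxy
  rw [he]
  nlinarith [sq_nonneg e]

theorem exists_isBoundedPerturbation (hT : T.generatorGraph = dirichletLaplacianGraph 𝕜)
    {W : ℝ → ℝ} (hW : MemLp (fun x => (W x : 𝕜)) ∞ halfLineMeasure) :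
    ∃ R : C0Semigroup 𝕜 (HalfLineL2 𝕜), T.IsBoundedPerturbation W R := by
  obtain ⟨R, hR⟩ := T.exists_perturbation (norm_op_le_of_dirichletLaplacian hT) (-mulOp hW)
  refine ⟨R, ?_⟩
  ext ⟨x, y⟩
  rw [hR]
  simp only [neg_apply, sub_neg_eq_add, mem_ofPred_eq]
  constructor
  · intro h
    refine ⟨_, h, ?_⟩
    filter_upwards [Lp.coeFn_add y (mulOp hW x), coeFn_mulOp hW x] with s h1 h2
    rw [h1, Pi.add_apply, h2, add_sub_cancel_right]
  · rintro ⟨g, hg, hy⟩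
    have : y + mulOp hW x = g := by
      refine Lp.ext ?_
      filter_upwards [Lp.coeFn_add y (mulOp hW x), coeFn_mulOp hW x, hy] with s h1 h2 h3
      rw [h1, Pi.add_apply, h2, h3, sub_add_cancel]
    rwa [this]

theorem abs_truncation_le_abs (V : ℝ → ℝ) (n : ℕ) (x : ℝ) : |truncation V n x| ≤ |V x| := by
  have hn : (0 : ℝ) ≤ n := n.cast_nonneg
  unfold truncation
  grind

theorem abs_truncation_le (V : ℝ → ℝ) (n : ℕ) (x : ℝ) : |truncation V n x| ≤ n := by
  have hn : (0 : ℝ) ≤ n := n.cast_nonneg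
  unfold truncation
  grind

theorem abs_sub_truncation_le_abs (V : ℝ → ℝ) (n : ℕ) (x : ℝ) :
    |V x - truncation V n x| ≤ |V x| := by
  have hn : (0 : ℝ) ≤ n := n.cast_nonneg
  unfold truncation
  grind

theorem truncation_eq_self {V : ℝ → ℝ} {n : ℕ} {x : ℝ} (h : |V x| ≤ n) :
    truncation V n x = V x := by
  unfold truncation
  grind

theorem aemeasurable_truncation {V : ℝ → ℝ} (hV : AEMeasurable V halfLineMeasure) (n : ℕ) :
    AEMeasurable (truncation V n) halfLineMeasure :=
  (hV.min aemeasurable_const).max aemeasurable_const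

theorem memLp_truncation {V : ℝ → ℝ} (hV : AEMeasurable V halfLineMeasure) (n : ℕ) :
    MemLp (fun x => (truncation V n x : 𝕜)) ∞ halfLineMeasure :=
  memLp_top_ofReal (aemeasurable_truncation hV n) (Eventually.of_forall (abs_truncation_le V n))

/-- Dominated convergence with majorant x|V(x)|. -/
theorem exists_firstMoment_sub_truncation {V : ℝ → ℝ} (hV : AEMeasurable V halfLineMeasure) {α : ℝ}
    (hα : FirstMomentLE V α) :
    ∃ δ : ℕ → ℝ, Tendsto δ atTop (𝓝 0) ∧ (∀ n, 0 ≤ δ n) ∧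
      ∀ n, FirstMomentLE (fun x => V x - truncation V n x) (δ n) := by
  set I : ℕ → ℝ≥0∞ := fun n => ∫⁻ x in Ioi (0 : ℝ), ENNReal.ofReal (x * |V x - truncation V n x|)
    with hI
  have hle : ∀ n, I n ≤ ENNReal.ofReal α := fun n =>
    hα.mono le_rfl (abs_sub_truncation_le_abs V n)
  have hfin : ∀ n, I n ≠ ⊤ := fun n => ne_top_of_le_ne_top ENNReal.ofReal_ne_top (hle n)
  have hlim : Tendsto I atTop (𝓝 0) := by
    have := tendsto_lintegral_of_dominated_convergence' (μ := halfLineMeasure)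
      (F := fun n x => ENNReal.ofReal (x * |V x - truncation V n x|)) (f := fun _ => 0)
      (fun x => ENNReal.ofReal (x * |V x|)) (fun n => ?_) (fun n => ?_)
      (ne_top_of_le_ne_top ENNReal.ofReal_ne_top hα) (Eventually.of_forall fun x => ?_)
    · simpa using this
    · have := aemeasurable_truncation hV n
      fun_prop
    · filter_upwards [ae_restrict_mem measurableSet_Ioi] with x hx
      exact ENNReal.ofReal_le_ofReal
        (mul_le_mul_of_nonneg_left (abs_sub_truncation_le_abs V n x) (le_of_lt hx))
    · obtain ⟨N, hN⟩ := exists_nat_ge |V x|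
      refine tendsto_const_nhds.congr' ?_
      filter_upwards [eventually_ge_atTop N] with n hn
      rw [truncation_eq_self (hN.trans (by exact_mod_cast hn))]
      simp
  refine ⟨fun n => (I n).toReal, ?_, fun n => ENNReal.toReal_nonneg, fun n => ?_⟩
  · simpa [Function.comp_def] using (ENNReal.tendsto_toReal ENNReal.zero_ne_top).comp hlim
  · exact (ENNReal.ofReal_toReal (hfin n)).ge

/-- The first moment of V_n − V_m is at most δ_n + δ_m, so the semigroups of the truncations are
Cauchy in operator norm, uniformly in time. -/
theorem exists_isPerturbation (hT : T.generatorGraph = dirichletLaplacianGraph 𝕜)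
    {V : ℝ → ℝ} (hV : AEMeasurable V halfLineMeasure) {α : ℝ} (hα0 : 0 ≤ α) (hα1 : α < 1)
    (hα : FirstMomentLE V α) : ∃ S : C0Semigroup 𝕜 (HalfLineL2 𝕜), T.IsPerturbation V S := by
  choose R hR using fun n => exists_isBoundedPerturbation hT (memLp_truncation (𝕜 := 𝕜) hV n)
  obtain ⟨δ, hδ, hδ0, hδV⟩ := exists_firstMoment_sub_truncation hV hα
  have hβ : 0 < 1 - α := sub_pos.2 hα1
  obtain ⟨S, hS⟩ := exists_limit R (δ := fun n => δ n / (2 * (1 - α)))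
    (by simpa using hδ.div_const (2 * (1 - α))) (fun n => by have := hδ0 n; positivity)
    (fun n m t f => by
      rw [← add_div]
      refine norm_op_sub_op_le hT (hR n) (hR m) (memLp_truncation hV n)
        (aemeasurable_truncation hV n) (aemeasurable_truncation hV m)
        (hα.mono le_rfl (abs_truncation_le_abs V n)) (hα.mono le_rfl (abs_truncation_le_abs V m))
        hα0 hα1 ((hδV n).add (hδV m) ?_ (hδ0 n) (hδ0 m) fun x => ?_)
        (add_nonneg (hδ0 n) (hδ0 m)) t f
      · exact hV.sub (aemeasurable_truncation hV n)
      · rw [add_comm]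
        refine le_trans (le_of_eq ?_) (abs_sub _ _)
        congr 1
        ring)
  exact ⟨S, R, hR, hS⟩

/-- If `W` is a bounded potential close to `V`, then `T_W(t)` is close to `T_V(t)`. -/
theorem IsPerturbation.norm_op_sub_op_le (hT : T.generatorGraph = dirichletLaplacianGraph 𝕜)
    {V : ℝ → ℝ} (hV : AEMeasurable V halfLineMeasure) {α ε : ℝ} (hα0 : 0 ≤ α) (hα1 : α < 1)
    (hα : FirstMomentLE V α) {S : C0Semigroup 𝕜 (HalfLineL2 𝕜)} (hS : T.IsPerturbation V S)
    {W : ℝ → ℝ} (hWm : AEMeasurable W halfLineMeasure) (hW : FirstMomentLE W α)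
    {R : C0Semigroup 𝕜 (HalfLineL2 𝕜)} (hR : T.IsBoundedPerturbation W R) (hε0 : 0 ≤ ε)
    (hε : FirstMomentLE (fun x => V x - W x) ε) (t : ℝ≥0) (f : HalfLineL2 𝕜) :
    ‖S.op t f - R.op t f‖ ≤ ε / (2 * (1 - α)) * ‖f‖ := by
  obtain ⟨R', hR', hlim⟩ := hS
  obtain ⟨δ, hδ, hδ0, hδV⟩ := exists_firstMoment_sub_truncation hV hα
  have h1 : Tendsto (fun n => (δ n + ε) / (2 * (1 - α)) * ‖f‖) atTop
      (𝓝 (ε / (2 * (1 - α)) * ‖f‖)) := by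
    simpa using ((hδ.add_const ε).div_const (2 * (1 - α))).mul_const ‖f‖
  refine le_of_tendsto_of_tendsto' (((hlim t f).sub_const _).norm) h1 fun n => ?_
  refine C0Semigroup.norm_op_sub_op_le hT (hR' n) hR (memLp_truncation hV n)
        (aemeasurable_truncation hV n) hWm
        (hα.mono le_rfl (abs_truncation_le_abs V n)) hW
        hα0 hα1 ((hδV n).add hε ?_ (hδ0 n) hε0 fun x => ?_)
        (add_nonneg (hδ0 n) hε0) t f
  · exact hV.sub (aemeasurable_truncation hV n)
  · rw [add_comm]
    refine le_trans (le_of_eq ?_) (abs_sub _ _)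
    congr 1
    ring

end Existence

end C0Semigroup

/-! ### The regularized modulus -/

section RegularizedModulus

variable {𝕜 : Type*} [RCLike 𝕜] {δ : ℝ}

/-- The smooth function `√(|z|² + δ²)`. -/
noncomputable def japanese (δ : ℝ) (z : 𝕜) : ℝ := √(‖z‖ ^ 2 + δ ^ 2)

/-- The regularized modulus `√(|z|² + δ²) - δ`. -/
noncomputable def regAbs (δ : ℝ) (z : 𝕜) : ℝ := japanese δ z - δ

/-- The gradient `z / √(|z|² + δ²)` of the regularized modulus. -/
noncomputable def regSign (δ : ℝ) (z : 𝕜) : 𝕜 := ((japanese δ z)⁻¹ : ℝ) * z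

theorem japanese_sq (z : 𝕜) : japanese δ z ^ 2 = ‖z‖ ^ 2 + δ ^ 2 :=
  Real.sq_sqrt (by positivity)

theorem japanese_pos (hδ : 0 < δ) (z : 𝕜) : 0 < japanese δ z :=
  Real.sqrt_pos.2 (by positivity)

theorem norm_le_japanese (hδ : 0 < δ) (z : 𝕜) : ‖z‖ ≤ japanese δ z := by
  refine le_of_sq_le_sq ?_ (japanese_pos hδ z).le
  rw [japanese_sq]; nlinarith [sq_nonneg δ]

theorem le_japanese (hδ : 0 < δ) (z : 𝕜) : δ ≤ japanese δ z := by
  refine le_of_sq_le_sq ?_ (japanese_pos hδ z).le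
  rw [japanese_sq]; nlinarith [sq_nonneg ‖z‖]

theorem japanese_zero (hδ : 0 < δ) : japanese δ (0 : 𝕜) = δ := by
  simp [japanese, Real.sqrt_sq hδ.le]

theorem regAbs_zero (hδ : 0 < δ) : regAbs δ (0 : 𝕜) = 0 := by
  rw [regAbs, japanese_zero hδ, sub_self]

theorem regSign_zero : regSign δ (0 : 𝕜) = 0 := mul_zero _

theorem regAbs_nonneg (hδ : 0 < δ) (z : 𝕜) : 0 ≤ regAbs δ z := sub_nonneg.2 (le_japanese hδ z)

theorem regAbs_le_norm (hδ : 0 < δ) (z : 𝕜) : regAbs δ z ≤ ‖z‖ := by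
  have : japanese δ z ≤ ‖z‖ + δ := by
    refine le_of_sq_le_sq ?_ (by positivity)
    rw [japanese_sq]
    nlinarith [norm_nonneg z]
  unfold regAbs; linarith

theorem norm_sub_le_regAbs (hδ : 0 < δ) (z : 𝕜) : ‖z‖ - δ ≤ regAbs δ z :=
  sub_le_sub_right (norm_le_japanese hδ z) δ

theorem norm_regSign (hδ : 0 < δ) (z : 𝕜) : ‖regSign δ z‖ = ‖z‖ / japanese δ z := by
  rw [regSign, norm_mul, RCLike.norm_ofReal, abs_of_pos (inv_pos.2 (japanese_pos hδ z)),
    inv_mul_eq_div]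

theorem norm_regSign_le_one (hδ : 0 < δ) (z : 𝕜) : ‖regSign δ z‖ ≤ 1 := by
  rw [norm_regSign hδ]
  exact div_le_one_of_le₀ (norm_le_japanese hδ z) (japanese_pos hδ z).le

/-- Convexity of the regularized modulus, in subgradient form. It comes down to the Cauchy–Schwarz
inequality ‖a‖‖b‖ + δ² ≤ `japanese δ a * japanese δ b` for the vectors (‖a‖, δ) and (‖b‖, δ). -/
theorem regAbs_sub_le (hδ : 0 < δ) (a b : 𝕜) :
    regAbs δ a - regAbs δ b ≤ RCLike.re (inner 𝕜 (regSign δ a) (a - b)) := by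
  have ha := japanese_pos hδ a
  have hb := japanese_pos hδ b
  have e : RCLike.re (inner 𝕜 (regSign δ a) (a - b))
      = (japanese δ a)⁻¹ * (‖a‖ ^ 2 - RCLike.re (inner 𝕜 a b)) := by
    have : regSign δ a = (((japanese δ a)⁻¹ : ℝ) : 𝕜) • a := rfl
    rw [this, inner_smul_left, RCLike.conj_ofReal, RCLike.re_ofReal_mul, inner_sub_right, map_sub,
      inner_self_eq_norm_sq]
  have h1 : ‖a‖ * ‖b‖ + δ ^ 2 ≤ japanese δ a * japanese δ b := by
    refine le_of_sq_le_sq ?_ (by positivity)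
    rw [mul_pow, japanese_sq, japanese_sq]
    nlinarith [mul_nonneg (sq_nonneg δ) (sq_nonneg (‖a‖ - ‖b‖))]
  have h2 : RCLike.re (inner 𝕜 a b) ≤ ‖a‖ * ‖b‖ :=
    (RCLike.re_le_norm _).trans (norm_inner_le_norm _ _)
  have h3 := japanese_sq (δ := δ) a
  rw [e, inv_mul_eq_div, le_div_iff₀ ha]
  unfold regAbs
  nlinarith

theorem lipschitzWith_regAbs (hδ : 0 < δ) : LipschitzWith 1 (regAbs δ : 𝕜 → ℝ) := by
  have h : ∀ a b : 𝕜, regAbs δ a - regAbs δ b ≤ ‖a - b‖ := fun a b =>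
    (regAbs_sub_le hδ a b).trans ((RCLike.re_le_norm _).trans ((norm_inner_le_norm _ _).trans
      (mul_le_of_le_one_left (norm_nonneg _) (norm_regSign_le_one hδ a))))
  refine LipschitzWith.of_dist_le_mul fun a b => ?_
  rw [Real.dist_eq, dist_eq_norm, NNReal.coe_one, one_mul]
  exact abs_le.2 ⟨by have := h b a; rw [norm_sub_rev] at this; linarith, h a b⟩

/-- Lipschitz continuity lets the gradient act continuously on L_2. The constant 2/δ collects 1/δ
from varying the numerator and 1/δ from varying the denominator. -/
theorem lipschitzWith_regSign (hδ : 0 < δ) :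
    LipschitzWith (2 / δ).toNNReal (regSign δ : 𝕜 → 𝕜) := by
  refine LipschitzWith.of_dist_le_mul fun a b => ?_
  have ha := japanese_pos hδ a
  have hb := japanese_pos hδ b
  rw [Real.coe_toNNReal _ (by positivity), dist_eq_norm, dist_eq_norm]
  have e : regSign δ a - regSign δ b = ((japanese δ a)⁻¹ : ℝ) * (a - b)
      + (((japanese δ a)⁻¹ * (japanese δ b - japanese δ a) : ℝ) : 𝕜) * regSign δ b := by
    have ha' : ((japanese δ a : ℝ) : 𝕜) ≠ 0 := by exact_mod_cast ha.ne'
    have hb' : ((japanese δ b : ℝ) : 𝕜) ≠ 0 := by exact_mod_cast hb.ne'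
    unfold regSign
    push_cast
    field_simp
    ring
  have h1 : |japanese δ b - japanese δ a| ≤ ‖a - b‖ := by
    have := (lipschitzWith_regAbs hδ).dist_le_mul b a
    rw [Real.dist_eq, dist_eq_norm, NNReal.coe_one, one_mul, norm_sub_rev] at this
    simpa [regAbs] using this
  have h2 : (japanese δ a)⁻¹ ≤ δ⁻¹ := inv_anti₀ hδ (le_japanese hδ a)
  rw [e]
  calc _ ≤ ‖(((japanese δ a)⁻¹ : ℝ) : 𝕜) * (a - b)‖
      + ‖(((japanese δ a)⁻¹ * (japanese δ b - japanese δ a) : ℝ) : 𝕜) * regSign δ b‖ :=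
        norm_add_le _ _
    _ = (japanese δ a)⁻¹ * ‖a - b‖
      + (japanese δ a)⁻¹ * |japanese δ b - japanese δ a| * ‖regSign δ b‖ := by
        rw [norm_mul, norm_mul, RCLike.norm_ofReal, RCLike.norm_ofReal, abs_mul,
          abs_of_pos (inv_pos.2 ha)]
    _ ≤ δ⁻¹ * ‖a - b‖ + δ⁻¹ * ‖a - b‖ * 1 := by
        gcongr
        exact norm_regSign_le_one hδ b
    _ = 2 / δ * ‖a - b‖ := by ring

theorem contDiff_japanese_comp (hδ : 0 < δ) {φ : ℝ → 𝕜} (hφ : ContDiff ℝ ∞ φ) :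
    ContDiff ℝ ∞ (fun x => japanese δ (φ x)) := by
  have h : (fun x => japanese δ (φ x))
      = fun x => √(RCLike.reCLM (φ x) ^ 2 + RCLike.imCLM (φ x) ^ 2 + δ ^ 2) := by
    ext x
    rw [japanese, RCLike.norm_sq_eq_def]
    simp [sq]
  rw [h]
  refine ContDiff.sqrt ?_ fun x => by positivity
  have h1 := (RCLike.reCLM (K := 𝕜)).contDiff.comp hφ
  have h2 := (RCLike.imCLM (K := 𝕜)).contDiff.comp hφ
  exact ((h1.pow 2).add (h2.pow 2)).add contDiff_const

theorem hasDerivAt_japanese_comp (hδ : 0 < δ) {φ : ℝ → 𝕜} {φ' : 𝕜} {x : ℝ}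
    (hφ : HasDerivAt φ φ' x) :
    HasDerivAt (fun x => japanese δ (φ x))
      (RCLike.re (inner 𝕜 (φ x) φ') / japanese δ (φ x)) x := by
  have h1 := hasDerivWithinAt_norm_sq_rclike (𝕜 := 𝕜) hφ.hasDerivWithinAt (s := univ)
  rw [hasDerivWithinAt_univ] at h1
  have h2 := (h1.add_const (δ ^ 2)).sqrt (by positivity)
  refine h2.congr_deriv ?_
  unfold japanese
  field_simp

theorem IsHalfLineTest.regAbs_comp (hδ : 0 < δ) {φ : ℝ → 𝕜} (hφ : IsHalfLineTest φ) :
    IsHalfLineTest (fun x => regAbs δ (φ x)) :=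
  ⟨(contDiff_japanese_comp hδ hφ.1).sub contDiff_const, hφ.2.1.comp_left (regAbs_zero hδ),
    (tsupport_comp_subset (regAbs_zero hδ) φ).trans hφ.2.2⟩

theorem IsHalfLineTest.weight_mul_regSign (hδ : 0 < δ) {φ : ℝ → 𝕜} (hφ : IsHalfLineTest φ)
    {ρ : ℝ → ℝ} (hρ : ContDiff ℝ ∞ ρ) :
    IsHalfLineTest (fun x => (ρ x : 𝕜) * regSign δ (φ x)) := by
  have h1 : ContDiff ℝ ∞ (fun x => ((ρ x * (japanese δ (φ x))⁻¹ : ℝ) : 𝕜)) :=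
    (RCLike.ofRealCLM (K := 𝕜)).contDiff.comp (hρ.mul
      ((contDiff_japanese_comp hδ hφ.1).inv fun x => (japanese_pos hδ _).ne'))
  have h2 := hφ.mul_left h1
  have e : (fun x => (ρ x : 𝕜) * regSign δ (φ x))
      = fun x => ((ρ x * (japanese δ (φ x))⁻¹ : ℝ) : 𝕜) * φ x := by
    ext x; unfold regSign; push_cast; ring
  rwa [e]

theorem hasDerivAt_weight_mul_regSign (hδ : 0 < δ) {φ : ℝ → 𝕜} {φ' : 𝕜} {ρ : ℝ → ℝ} {ρ' x : ℝ}
    (hφ : HasDerivAt φ φ' x) (hρ : HasDerivAt ρ ρ' x) :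
    HasDerivAt (fun x => (ρ x : 𝕜) * regSign δ (φ x))
      (((ρ' / japanese δ (φ x) - ρ x * RCLike.re (inner 𝕜 (φ x) φ') / japanese δ (φ x) ^ 3 : ℝ) : 𝕜)
        * φ x + ((ρ x / japanese δ (φ x) : ℝ) : 𝕜) * φ') x := by
  have hs := japanese_pos hδ (φ x)
  have h0 : HasDerivAt (fun x => ρ x / japanese δ (φ x))
      (ρ' / japanese δ (φ x) - ρ x * RCLike.re (inner 𝕜 (φ x) φ') / japanese δ (φ x) ^ 3) x := by
    refine (hρ.fun_div (hasDerivAt_japanese_comp hδ hφ) hs.ne').congr_deriv ?_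
    field_simp
  have h1 := (RCLike.ofRealCLM (K := 𝕜)).hasFDerivAt.comp_hasDerivAt x h0
  have h2 := h1.fun_mul hφ
  refine (h2.congr_of_eventuallyEq (Eventually.of_forall fun y => ?_)).congr_deriv ?_
  · simp only [regSign, Function.comp, RCLike.ofRealCLM_apply, div_eq_mul_inv]
    push_cast
    ring
  · simp [Function.comp]

end RegularizedModulus

/-! ### Kato's inequality with weights -/

section Kato

variable {𝕜 : Type*} [RCLike 𝕜] {δ : ℝ}

local notation "⟪" x ", " y "⟫" => inner 𝕜 x y

/-- The regularized modulus on `L_2(0, ∞)`. -/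
noncomputable def regAbsLp (hδ : 0 < δ) (u : HalfLineL2 𝕜) : HalfLineL2 ℝ :=
  (lipschitzWith_regAbs (𝕜 := 𝕜) hδ).compLp (regAbs_zero hδ) u

/-- The gradient of the regularized modulus on `L_2(0, ∞)`. -/
noncomputable def regSignLp (hδ : 0 < δ) (u : HalfLineL2 𝕜) : HalfLineL2 𝕜 :=
  (lipschitzWith_regSign (𝕜 := 𝕜) hδ).compLp regSign_zero u

theorem coeFn_regAbsLp (hδ : 0 < δ) (u : HalfLineL2 𝕜) :
    ∀ᵐ x ∂halfLineMeasure, regAbsLp hδ u x = regAbs δ (u x) :=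
  LipschitzWith.coeFn_compLp (lipschitzWith_regAbs (𝕜 := 𝕜) hδ) (regAbs_zero hδ) u

theorem coeFn_regSignLp (hδ : 0 < δ) (u : HalfLineL2 𝕜) :
    ∀ᵐ x ∂halfLineMeasure, regSignLp hδ u x = regSign δ (u x) :=
  LipschitzWith.coeFn_compLp (lipschitzWith_regSign (𝕜 := 𝕜) hδ) regSign_zero u

theorem continuous_regAbsLp (hδ : 0 < δ) : Continuous (regAbsLp hδ : HalfLineL2 𝕜 → HalfLineL2 ℝ) :=
  LipschitzWith.continuous_compLp (lipschitzWith_regAbs (𝕜 := 𝕜) hδ) (regAbs_zero hδ)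

theorem continuous_regSignLp (hδ : 0 < δ) :
    Continuous (regSignLp hδ : HalfLineL2 𝕜 → HalfLineL2 𝕜) :=
  LipschitzWith.continuous_compLp (lipschitzWith_regSign (𝕜 := 𝕜) hδ) regSign_zero

theorem inner_regAbsLp (hδ : 0 < δ) {m : ℝ → ℝ} (hm : MemLp m 2 halfLineMeasure)
    (u : HalfLineL2 𝕜) :
    inner ℝ (hm.toLp m) (regAbsLp hδ u) = ∫ x in Ioi (0 : ℝ), m x * regAbs δ (u x) := by
  rw [L2.inner_def]
  refine integral_congr_ae ?_
  filter_upwards [hm.coeFn_toLp, coeFn_regAbsLp hδ u] with x h1 h2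
  rw [h1, h2, RCLike.inner_apply, conj_trivial, mul_comm]

theorem integrable_mul_regAbs (hδ : 0 < δ) {m : ℝ → ℝ} (hm : MemLp m 2 halfLineMeasure)
    (u : HalfLineL2 𝕜) :
    IntegrableOn (fun x => m x * regAbs δ (u x)) (Ioi 0) := by
  have h := hm.integrable_mul (Lp.memLp (regAbsLp hδ u))
  refine h.congr ?_
  filter_upwards [coeFn_regAbsLp hδ u] with x hx
  simp [hx]

/-- A smooth bounded weight `ρ` on `(0, ∞)` with `ρ'' + Q ρ ≤ κ² ρ`. -/
structure IsSuperWeight (ρ Q : ℝ → ℝ) (κ : ℝ) : Prop where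
  contDiff : ContDiff ℝ ∞ ρ
  nonneg : ∀ x, 0 < x → 0 ≤ ρ x
  bounded : ∃ C, ∀ x, 0 < x → ρ x ≤ C
  deriv_bounded : ∃ C, ∀ x, 0 < x → |deriv ρ x| ≤ C
  integrable : IntegrableOn ρ (Ioi 0)
  measurable : AEMeasurable Q halfLineMeasure
  potential_nonneg : ∀ x, 0 < x → 0 ≤ Q x
  potential_bounded : ∃ C, ∀ x, 0 < x → Q x ≤ C
  deriv_deriv_le : ∀ x, 0 < x → deriv (deriv ρ) x ≤ (κ ^ 2 - Q x) * ρ x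

namespace IsSuperWeight

variable {ρ Q : ℝ → ℝ} {κ : ℝ}

theorem memLp_top (h : IsSuperWeight ρ Q κ) : MemLp (fun x => (ρ x : 𝕜)) ∞ halfLineMeasure := by
  obtain ⟨C, hC⟩ := h.bounded
  refine memLp_top_ofReal h.contDiff.continuous.aemeasurable (C := C) ?_
  filter_upwards [ae_restrict_mem measurableSet_Ioi] with x hx
  rw [abs_of_nonneg (h.nonneg x hx)]
  exact hC x hx

theorem memLp (h : IsSuperWeight ρ Q κ) : MemLp ρ 2 halfLineMeasure := by
  obtain ⟨C, hC⟩ := h.bounded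
  rw [memLp_two_iff_integrable_sq h.contDiff.continuous.aestronglyMeasurable]
  refine (h.integrable.const_mul C).mono'
    (h.contDiff.continuous.pow 2).aestronglyMeasurable ?_
  filter_upwards [ae_restrict_mem measurableSet_Ioi] with x hx
  rw [Real.norm_of_nonneg (sq_nonneg _), sq]
  exact mul_le_mul_of_nonneg_right (hC x hx) (h.nonneg x hx)

theorem aemeasurable_mul (h : IsSuperWeight ρ Q κ) :
    AEMeasurable (fun x => Q x * ρ x) halfLineMeasure :=
  h.measurable.mul h.contDiff.continuous.aemeasurable

theorem integrable_mul (h : IsSuperWeight ρ Q κ) : IntegrableOn (fun x => Q x * ρ x) (Ioi 0) := by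
  obtain ⟨C, hC⟩ := h.potential_bounded
  refine (h.integrable.const_mul C).mono' h.aemeasurable_mul.aestronglyMeasurable ?_
  filter_upwards [ae_restrict_mem measurableSet_Ioi] with x hx
  rw [Real.norm_of_nonneg (mul_nonneg (h.potential_nonneg x hx) (h.nonneg x hx))]
  exact mul_le_mul_of_nonneg_right (hC x hx) (h.nonneg x hx)

theorem memLp_mul (h : IsSuperWeight ρ Q κ) : MemLp (fun x => Q x * ρ x) 2 halfLineMeasure := by
  obtain ⟨C, hC⟩ := h.potential_bounded
  refine (h.memLp.const_mul C).mono h.aemeasurable_mul.aestronglyMeasurable ?_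
  filter_upwards [ae_restrict_mem measurableSet_Ioi] with x hx
  have h1 := mul_le_mul_of_nonneg_right (hC x hx) (h.nonneg x hx)
  rw [Real.norm_of_nonneg (mul_nonneg (h.potential_nonneg x hx) (h.nonneg x hx))]
  exact h1.trans (le_abs_self _)

theorem memLp_sub (h : IsSuperWeight ρ Q κ) :
    MemLp (fun x => (κ ^ 2 - Q x) * ρ x) 2 halfLineMeasure := by
  have := (h.memLp.const_mul (κ ^ 2)).sub h.memLp_mul
  refine this.ae_eq (Eventually.of_forall fun x => ?_)
  simp only [Pi.sub_apply]
  ring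

/-- Kato's inequality for a test function φ. With γ the regularized modulus of φ, J = `japanese δ (φ
x)` and r = Re⟨φ, φ'⟩, the right-hand integrand is ρ'γ' plus ρ J⁻³ (J²|φ'|² − r²), which is
nonnegative by Cauchy–Schwarz. As γ has compact support in (0, ∞), ∫ρ'γ' = −∫ρ''γ without boundary
terms, and ρ'' ≤ (κ² − Q)ρ finishes. -/
theorem neg_integral_le_re_inner_deriv (h : IsSuperWeight ρ Q κ) (hδ : 0 < δ) {φ : ℝ → 𝕜}
    (hφ : IsHalfLineTest φ) :
    -inner ℝ (h.memLp_sub.toLp _) (regAbsLp hδ hφ.toLp)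
      ≤ RCLike.re ⟪(hφ.weight_mul_regSign hδ h.contDiff).deriv.toLp, hφ.deriv.toLp⟫ := by
  set ψ := fun x => (ρ x : 𝕜) * regSign δ (φ x) with hψdef
  have hψ : IsHalfLineTest ψ := hφ.weight_mul_regSign hδ h.contDiff
  set γ : ℝ → ℝ := fun x => regAbs δ (φ x) with hγdef
  have hγ : IsHalfLineTest γ := hφ.regAbs_comp hδ
  have hρ1 : ContDiff ℝ ∞ (deriv ρ) := (contDiff_infty_iff_deriv.1 h.contDiff).2
  have hρ2 : ContDiff ℝ ∞ (deriv (deriv ρ)) := (contDiff_infty_iff_deriv.1 hρ1).2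
  have hρd : ∀ x, HasDerivAt ρ (deriv ρ x) x := fun x =>
    (h.contDiff.differentiable (by simp) x).hasDerivAt
  have hρd' : ∀ x, HasDerivAt (deriv ρ) (deriv (deriv ρ) x) x := fun x =>
    (hρ1.differentiable (by simp) x).hasDerivAt
  have i1 : IntegrableOn (fun x => deriv (deriv ρ) x * γ x) (Ioi 0) :=
    (hγ.mul_left hρ2).integrable.integrableOn
  have i2 : IntegrableOn (fun x => deriv ρ x * deriv γ x) (Ioi 0) :=
    (hγ.deriv.mul_left hρ1).integrable.integrableOn
  have e1 : ∫ x in Ioi (0 : ℝ), deriv ρ x * deriv γ x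
      = -∫ x in Ioi (0 : ℝ), deriv (deriv ρ) x * γ x := by
    have h0 := (hγ.mul_left hρ1).integral_deriv
    rw [integral_congr_ae (Eventually.of_forall fun x =>
      ((hρd' x).fun_mul (hγ.hasDerivAt x)).deriv), integral_add i1 i2] at h0
    linarith
  have e2 : inner ℝ (h.memLp_sub.toLp _) (regAbsLp hδ hφ.toLp)
      = ∫ x in Ioi (0 : ℝ), (κ ^ 2 - Q x) * ρ x * γ x := by
    rw [inner_regAbsLp]
    refine integral_congr_ae ?_
    filter_upwards [hφ.coeFn_toLp] with x hx
    rw [hx]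
  have i3 : IntegrableOn (fun x => (κ ^ 2 - Q x) * ρ x * γ x) (Ioi 0) := by
    refine (integrable_mul_regAbs hδ h.memLp_sub hφ.toLp).congr ?_
    filter_upwards [hφ.coeFn_toLp] with x hx
    rw [hx]
  have e3 : ∫ x in Ioi (0 : ℝ), deriv (deriv ρ) x * γ x
      ≤ ∫ x in Ioi (0 : ℝ), (κ ^ 2 - Q x) * ρ x * γ x := by
    refine setIntegral_mono_on i1 i3 measurableSet_Ioi fun x hx => ?_
    exact mul_le_mul_of_nonneg_right (h.deriv_deriv_le x hx) (regAbs_nonneg hδ _)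
  have i4 : IntegrableOn (fun x => deriv φ x * star (deriv ψ x)) (Ioi 0) :=
    (hψ.deriv.star.mul_left hφ.deriv.1).integrable.integrableOn
  have e4 : RCLike.re ⟪hψ.deriv.toLp, hφ.deriv.toLp⟫
      = ∫ x in Ioi (0 : ℝ), RCLike.re (deriv φ x * star (deriv ψ x)) := by
    rw [integral_re i4, IsHalfLineTest.inner_toLp]
    congr 1
    refine integral_congr_ae ?_
    filter_upwards [hφ.deriv.coeFn_toLp] with x hx
    rw [hx]
  rw [e2, e4]
  refine le_trans ?_ (le_trans e1.ge ?_)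
  · linarith
  refine setIntegral_mono_on i2 i4.re measurableSet_Ioi fun x hx => ?_
  have hs := japanese_pos hδ (φ x)
  have d1 : deriv γ x = RCLike.re (inner 𝕜 (φ x) (deriv φ x)) / japanese δ (φ x) :=
    ((hasDerivAt_japanese_comp hδ (hφ.hasDerivAt x)).sub_const δ).deriv
  have d2 := (hasDerivAt_weight_mul_regSign hδ (hφ.hasDerivAt x) (hρd x)).deriv
  rw [← hψdef] at d2
  have d3 : deriv φ x * star (deriv ψ x) = inner 𝕜 (deriv ψ x) (deriv φ x) := by
    rw [RCLike.inner_apply]; rfl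
  set r := RCLike.re (inner 𝕜 (φ x) (deriv φ x)) with hr
  have d4 : RCLike.re (deriv φ x * star (deriv ψ x))
      = (deriv ρ x / japanese δ (φ x) - ρ x * r / japanese δ (φ x) ^ 3) * r
        + ρ x / japanese δ (φ x) * ‖deriv φ x‖ ^ 2 := by
    have hmul : ∀ (a : ℝ) (z z' : 𝕜), ⟪(a : 𝕜) * z, z'⟫ = (a : 𝕜) * ⟪z, z'⟫ := fun a z z' => by
      rw [← smul_eq_mul, inner_smul_left, RCLike.conj_ofReal]
    rw [d3, d2, inner_add_left, hmul, hmul, map_add, RCLike.re_ofReal_mul, RCLike.re_ofReal_mul,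
      inner_self_eq_norm_sq]
  have d5 : r ^ 2 ≤ japanese δ (φ x) ^ 2 * ‖deriv φ x‖ ^ 2 := by
    have : |r| ≤ ‖φ x‖ * ‖deriv φ x‖ := (RCLike.abs_re_le_norm _).trans (norm_inner_le_norm _ _)
    rw [← sq_abs, ← mul_pow]
    refine pow_le_pow_left₀ (abs_nonneg r) (this.trans ?_) 2
    gcongr
    exact norm_le_japanese hδ _
  show deriv ρ x * deriv γ x ≤ RCLike.re (deriv φ x * star (deriv ψ x))
  rw [d4, d1]
  have d6 : (deriv ρ x / japanese δ (φ x) - ρ x * r / japanese δ (φ x) ^ 3) * r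
        + ρ x / japanese δ (φ x) * ‖deriv φ x‖ ^ 2 - deriv ρ x * (r / japanese δ (φ x))
      = ρ x / japanese δ (φ x) ^ 3 * (japanese δ (φ x) ^ 2 * ‖deriv φ x‖ ^ 2 - r ^ 2) := by
    field_simp
    ring
  have d7 : 0 ≤ ρ x / japanese δ (φ x) ^ 3 * (japanese δ (φ x) ^ 2 * ‖deriv φ x‖ ^ 2 - r ^ 2) :=
    mul_nonneg (div_nonneg (h.nonneg x hx) (by positivity)) (by linarith)
  linarith

/-- Boundedness suffices for the limit in Kato's inequality, where this derivative is paired with a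
sequence tending to 0. The product rule gives one term with ρ' and two with ρ, each carrying a
factor at most 1/δ; this explains the constant (C₁ + 2C₀)/δ. -/
theorem exists_norm_deriv_le (h : IsSuperWeight ρ Q κ) (hδ : 0 < δ) :
    ∃ C, ∀ (φ : ℝ → 𝕜) (hφ : IsHalfLineTest φ),
      ‖(hφ.weight_mul_regSign hδ h.contDiff).deriv.toLp‖
        ≤ C * (‖hφ.toLp‖ + ‖hφ.deriv.toLp‖) := by
  obtain ⟨C₀, hC₀⟩ := h.bounded
  obtain ⟨C₁, hC₁⟩ := h.deriv_bounded
  have hC₀' : 0 ≤ C₀ := (h.nonneg 1 one_pos).trans (hC₀ 1 one_pos)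
  have hC₁' : 0 ≤ C₁ := (abs_nonneg _).trans (hC₁ 1 one_pos)
  set C := (C₁ + 2 * C₀) / δ with hC
  have hC' : 0 ≤ C := by positivity
  refine ⟨C, fun φ hφ => ?_⟩
  set N : HalfLineL2 𝕜 → HalfLineL2 ℝ := fun u => lipschitzWith_one_norm.compLp norm_zero u with hN
  have hNn : ∀ u, ‖N u‖ ≤ ‖u‖ := fun u => by
    simpa using (lipschitzWith_one_norm (E := 𝕜)).norm_compLp_le norm_zero u
  have hNc : ∀ u, ∀ᵐ x ∂halfLineMeasure, N u x = ‖u x‖ := fun u =>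
    (lipschitzWith_one_norm (E := 𝕜)).coeFn_compLp norm_zero u
  have key : ‖(hφ.weight_mul_regSign hδ h.contDiff).deriv.toLp‖
      ≤ ‖C • (N hφ.toLp + N hφ.deriv.toLp)‖ := by
    refine Lp.norm_le_norm_of_ae_le ?_
    filter_upwards [(hφ.weight_mul_regSign hδ h.contDiff).deriv.coeFn_toLp, hφ.coeFn_toLp,
      hφ.deriv.coeFn_toLp, hNc hφ.toLp, hNc hφ.deriv.toLp,
      Lp.coeFn_smul C (N hφ.toLp + N hφ.deriv.toLp), Lp.coeFn_add (N hφ.toLp) (N hφ.deriv.toLp),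
      ae_restrict_mem measurableSet_Ioi] with x a1 a2 a3 a4 a5 a6 a7 hx
    have hs := japanese_pos hδ (φ x)
    have hsδ := le_japanese hδ (φ x)
    rw [a1, a6, Pi.smul_apply, a7, Pi.add_apply, a4, a5, a2, a3, smul_eq_mul,
      Real.norm_of_nonneg (by positivity),
      (hasDerivAt_weight_mul_regSign hδ (hφ.hasDerivAt x)
        ((h.contDiff.differentiable (by simp) x).hasDerivAt)).deriv]
    set r := RCLike.re (inner 𝕜 (φ x) (deriv φ x)) with hr
    have b1 : |r| ≤ ‖φ x‖ * ‖deriv φ x‖ := (RCLike.abs_re_le_norm _).trans (norm_inner_le_norm _ _)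
    have b2 : ‖φ x‖ / japanese δ (φ x) ≤ 1 :=
      div_le_one_of_le₀ (norm_le_japanese hδ _) hs.le
    have b3 : (japanese δ (φ x))⁻¹ ≤ δ⁻¹ := inv_anti₀ hδ hsδ
    have hρ0 := h.nonneg x hx
    have hρC := hC₀ x hx
    refine (norm_add_le _ _).trans ?_
    rw [norm_mul, norm_mul, RCLike.norm_ofReal, RCLike.norm_ofReal,
      abs_of_nonneg (div_nonneg hρ0 hs.le)]
    have b4 : |deriv ρ x / japanese δ (φ x) - ρ x * r / japanese δ (φ x) ^ 3|
        ≤ |deriv ρ x| / japanese δ (φ x) + ρ x * |r| / japanese δ (φ x) ^ 3 := by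
      refine (abs_sub _ _).trans (le_of_eq ?_)
      rw [abs_div, abs_div, abs_mul, abs_of_pos hs, abs_of_pos (pow_pos hs 3), abs_of_nonneg hρ0]
    calc _ ≤ (|deriv ρ x| / japanese δ (φ x) + ρ x * |r| / japanese δ (φ x) ^ 3) * ‖φ x‖
          + ρ x / japanese δ (φ x) * ‖deriv φ x‖ := by gcongr
      _ ≤ (|deriv ρ x| / japanese δ (φ x)
            + ρ x * (‖φ x‖ * ‖deriv φ x‖) / japanese δ (φ x) ^ 3) * ‖φ x‖
          + ρ x / japanese δ (φ x) * ‖deriv φ x‖ := by gcongr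
      _ = |deriv ρ x| * (japanese δ (φ x))⁻¹ * ‖φ x‖
          + ρ x * (japanese δ (φ x))⁻¹ * (‖φ x‖ / japanese δ (φ x)) ^ 2 * ‖deriv φ x‖
          + ρ x * (japanese δ (φ x))⁻¹ * ‖deriv φ x‖ := by field_simp
      _ ≤ C₁ * δ⁻¹ * ‖φ x‖ + C₀ * δ⁻¹ * 1 ^ 2 * ‖deriv φ x‖ + C₀ * δ⁻¹ * ‖deriv φ x‖ := by
          gcongr
          exact hC₁ x hx
      _ ≤ C * (‖φ x‖ + ‖deriv φ x‖) := by
          have p1 : 0 ≤ C₀ * δ⁻¹ * ‖φ x‖ := by positivity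
          have p2 : 0 ≤ C₁ * δ⁻¹ * ‖deriv φ x‖ := by positivity
          have : C = C₁ * δ⁻¹ + 2 * (C₀ * δ⁻¹) := by rw [hC]; field_simp
          rw [this]
          nlinarith
  refine key.trans ?_
  rw [norm_smul, Real.norm_of_nonneg hC']
  exact mul_le_mul_of_nonneg_left ((norm_add_le _ _).trans (add_le_add (hNn _) (hNn _))) hC'

/-- Kato's inequality with weights for the Dirichlet Laplacian. -/
theorem re_inner_le_inner_regAbsLp (h : IsSuperWeight ρ Q κ) (hδ : 0 < δ) {u v : HalfLineL2 𝕜}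
    (huv : (u, v) ∈ dirichletLaplacianGraph 𝕜) :
    RCLike.re ⟪mulOp h.memLp_top (regSignLp hδ u), v⟫
      ≤ inner ℝ (h.memLp_sub.toLp _) (regAbsLp hδ u) := by
  obtain ⟨w, φ, hφ, t1, t2, hw⟩ := exists_weak_derivative huv
  obtain ⟨C, hC⟩ := h.exists_norm_deriv_le (𝕜 := 𝕜) hδ
  have e : ∀ n, mulOp h.memLp_top (regSignLp hδ (hφ n).toLp)
      = ((hφ n).weight_mul_regSign hδ h.contDiff).toLp := by
    intro n
    refine Lp.ext ?_
    filter_upwards [coeFn_mulOp (𝕜 := 𝕜) h.memLp_top (regSignLp hδ (hφ n).toLp),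
      coeFn_regSignLp hδ (hφ n).toLp, (hφ n).coeFn_toLp,
      ((hφ n).weight_mul_regSign hδ h.contDiff).coeFn_toLp] with x a1 a2 a3 a4
    rw [a1, a2, a3, a4]
  have l1 : Tendsto (fun n => RCLike.re ⟪mulOp h.memLp_top (regSignLp hδ (hφ n).toLp), v⟫) atTop
      (𝓝 (RCLike.re ⟪mulOp h.memLp_top (regSignLp hδ u), v⟫)) := by
    refine (RCLike.continuous_re.tendsto _).comp (Tendsto.inner ?_ tendsto_const_nhds)
    exact (((mulOp h.memLp_top).continuous.comp (continuous_regSignLp hδ)).tendsto u).comp t1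
  have l2 : Tendsto (fun n => inner ℝ (h.memLp_sub.toLp _) (regAbsLp hδ (hφ n).toLp)
      + C * (‖(hφ n).toLp‖ + ‖(hφ n).deriv.toLp‖) * ‖(hφ n).deriv.toLp - w‖) atTop
      (𝓝 (inner ℝ (h.memLp_sub.toLp _) (regAbsLp hδ u) + C * (‖u‖ + ‖w‖) * ‖w - w‖)) := by
    refine Tendsto.add ?_ (((t1.norm.add t2.norm).const_mul C).mul (t2.sub_const w).norm)
    exact tendsto_const_nhds.inner (((continuous_regAbsLp hδ).tendsto u).comp t1)
  rw [sub_self, norm_zero, mul_zero, add_zero] at l2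
  refine le_of_tendsto_of_tendsto' l1 l2 fun n => ?_
  rw [e n]
  set ψ := (hφ n).weight_mul_regSign hδ h.contDiff
  -- The weak derivative w is replaced by that of φ n; the error is a bounded factor times ‖(φ n)' −
  -- w‖ and vanishes in the limit.
  have h1 := hw _ ψ
  have h2 : ⟪ψ.toLp, v⟫ = -⟪ψ.deriv.toLp, (hφ n).deriv.toLp⟫
      + ⟪ψ.deriv.toLp, (hφ n).deriv.toLp - w⟫ := by
    rw [inner_sub_right, h1]; ring
  have h3 := h.neg_integral_le_re_inner_deriv hδ (hφ n)
  have h4 : RCLike.re ⟪ψ.deriv.toLp, (hφ n).deriv.toLp - w⟫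
      ≤ C * (‖(hφ n).toLp‖ + ‖(hφ n).deriv.toLp‖) * ‖(hφ n).deriv.toLp - w‖ :=
    (RCLike.re_le_norm _).trans ((norm_inner_le_norm _ _).trans
      (mul_le_mul_of_nonneg_right (hC _ (hφ n)) (norm_nonneg _)))
  rw [h2, map_add, map_neg]
  linarith

end IsSuperWeight

end Kato

/-! ### Weighted L_1-growth for bounded potentials -/

section WeightedGronwall

variable {𝕜 : Type*} [RCLike 𝕜] {δ : ℝ} {ρ Q : ℝ → ℝ} {κ : ℝ}

local notation "⟪" x ", " y "⟫" => inner 𝕜 x y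

namespace IsSuperWeight

theorem re_inner_mulOp_regSignLp (h : IsSuperWeight ρ Q κ) (hδ : 0 < δ) (u v : HalfLineL2 𝕜) :
    IntegrableOn (fun x => ρ x * RCLike.re (inner 𝕜 (regSign δ (u x)) (v x))) (Ioi 0) ∧
    RCLike.re ⟪mulOp h.memLp_top (regSignLp hδ u), v⟫
      = ∫ x in Ioi (0 : ℝ), ρ x * RCLike.re (inner 𝕜 (regSign δ (u x)) (v x)) := by
  have hi := L2.integrable_inner (𝕜 := 𝕜) (mulOp h.memLp_top (regSignLp hδ u)) v
  have e : ∀ᵐ x ∂halfLineMeasure,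
      RCLike.re (inner 𝕜 (mulOp h.memLp_top (regSignLp hδ u) x) (v x))
        = ρ x * RCLike.re (inner 𝕜 (regSign δ (u x)) (v x)) := by
    filter_upwards [coeFn_mulOp (𝕜 := 𝕜) h.memLp_top (regSignLp hδ u), coeFn_regSignLp hδ u]
      with x a1 a2
    rw [a1, a2, ← smul_eq_mul, inner_smul_left, RCLike.conj_ofReal, RCLike.re_ofReal_mul]
  refine ⟨hi.re.congr e, ?_⟩
  rw [L2.inner_def, ← integral_re hi]
  exact integral_congr_ae e

/-- The integrated form of `regAbs_sub_le`: the subgradient inequality that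
`le_gronwallBound_of_convex` asks for. -/
theorem inner_sub_le_re_inner (h : IsSuperWeight ρ Q κ) (hδ : 0 < δ) (a b : HalfLineL2 𝕜) :
    inner ℝ (h.memLp.toLp _) (regAbsLp hδ a) - inner ℝ (h.memLp.toLp _) (regAbsLp hδ b)
      ≤ RCLike.re ⟪mulOp h.memLp_top (regSignLp hδ a), a - b⟫ := by
  obtain ⟨hi, he⟩ := h.re_inner_mulOp_regSignLp hδ a (a - b)
  rw [he, inner_regAbsLp, inner_regAbsLp, ← integral_sub (integrable_mul_regAbs hδ h.memLp a)
    (integrable_mul_regAbs hδ h.memLp b)]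
  refine integral_mono_ae ((integrable_mul_regAbs hδ h.memLp a).sub
    (integrable_mul_regAbs hδ h.memLp b)) hi ?_
  filter_upwards [Lp.coeFn_sub a b, ae_restrict_mem measurableSet_Ioi] with x hx hx0
  rw [hx, Pi.sub_apply, ← mul_sub]
  exact mul_le_mul_of_nonneg_left (regAbs_sub_le hδ _ _) (h.nonneg x hx0)

/-- The potential contributes at most ∫Qρ√(|u|²+δ²), that is, ∫Qρ times the regularized modulus plus
δ∫Qρ. The former cancels against the −Q in Kato's inequality, which leaves κ² and an error of order
δ. -/
theorem re_inner_le_of_isBoundedPerturbation (h : IsSuperWeight ρ Q κ) (hδ : 0 < δ)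
    {T R : C0Semigroup 𝕜 (HalfLineL2 𝕜)} {W : ℝ → ℝ}
    (hT : T.generatorGraph = dirichletLaplacianGraph 𝕜) (hR : T.IsBoundedPerturbation W R)
    (hW : ∀ x, 0 < x → |W x| ≤ Q x) {u y : HalfLineL2 𝕜} (huy : (u, y) ∈ R.generatorGraph) :
    RCLike.re ⟪mulOp h.memLp_top (regSignLp hδ u), y⟫
      ≤ κ ^ 2 * inner ℝ (h.memLp.toLp _) (regAbsLp hδ u)
        + δ * ∫ x in Ioi (0 : ℝ), Q x * ρ x := by
  rw [hR] at huy
  obtain ⟨g, hg, hy⟩ := huy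
  rw [hT] at hg
  have k := h.re_inner_le_inner_regAbsLp hδ hg
  obtain ⟨hi, he⟩ := h.re_inner_mulOp_regSignLp hδ u (y - g)
  have e1 : RCLike.re ⟪mulOp h.memLp_top (regSignLp hδ u), y⟫
      = RCLike.re ⟪mulOp h.memLp_top (regSignLp hδ u), g⟫
        + RCLike.re ⟪mulOp h.memLp_top (regSignLp hδ u), y - g⟫ := by
    rw [inner_sub_right, map_sub]; ring
  have i1 := integrable_mul_regAbs hδ h.memLp_mul u
  have i2 := h.integrable_mul.const_mul δ
  have i3 := integrable_mul_regAbs hδ h.memLp u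
  have e2 : RCLike.re ⟪mulOp h.memLp_top (regSignLp hδ u), y - g⟫
      ≤ (∫ x in Ioi (0 : ℝ), Q x * ρ x * regAbs δ (u x))
        + δ * ∫ x in Ioi (0 : ℝ), Q x * ρ x := by
    rw [he, ← integral_const_mul, ← integral_add i1 i2]
    refine integral_mono_ae hi (i1.add i2) ?_
    filter_upwards [Lp.coeFn_sub y g, hy, ae_restrict_mem measurableSet_Ioi] with x h1 h2 hx
    have hs := japanese_pos hδ (u x)
    have h3 : (y - g) x = ((-W x : ℝ) : 𝕜) * u x := by
      rw [h1, Pi.sub_apply, h2]; push_cast; ring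
    have h4 : RCLike.re (inner 𝕜 (regSign δ (u x)) ((y - g) x)) ≤ Q x * japanese δ (u x) := by
      refine (RCLike.re_le_norm _).trans ((norm_inner_le_norm _ _).trans ?_)
      rw [h3, norm_mul, RCLike.norm_ofReal, abs_neg]
      calc _ ≤ 1 * (Q x * japanese δ (u x)) := by
            gcongr
            · exact norm_regSign_le_one hδ _
            · exact h.potential_nonneg x hx
            · exact hW x hx
            · exact norm_le_japanese hδ _
        _ = _ := one_mul _
    calc ρ x * RCLike.re (inner 𝕜 (regSign δ (u x)) ((y - g) x))
        ≤ ρ x * (Q x * japanese δ (u x)) := mul_le_mul_of_nonneg_left h4 (h.nonneg x hx)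
      _ = Q x * ρ x * regAbs δ (u x) + δ * (Q x * ρ x) := by unfold regAbs; ring
  have e3 : inner ℝ (h.memLp_sub.toLp _) (regAbsLp hδ u)
      + ∫ x in Ioi (0 : ℝ), Q x * ρ x * regAbs δ (u x)
      = κ ^ 2 * inner ℝ (h.memLp.toLp _) (regAbsLp hδ u) := by
    rw [inner_regAbsLp, inner_regAbsLp,
      ← integral_add (integrable_mul_regAbs hδ h.memLp_sub u) i1, ← integral_const_mul]
    congr 1
    ext x
    ring
  rw [e1]
  linarith

theorem integrable_mul_norm (h : IsSuperWeight ρ Q κ) (u : HalfLineL2 𝕜) :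
    IntegrableOn (fun x => ρ x * ‖u x‖) (Ioi 0) :=
  h.memLp.integrable_mul (Lp.memLp u).norm

/-- Weighted `L_1`-estimate for a bounded perturbation of the Dirichlet Laplacian. -/
theorem integral_mul_norm_op_le (h : IsSuperWeight ρ Q κ)
    {T R : C0Semigroup 𝕜 (HalfLineL2 𝕜)} {W : ℝ → ℝ}
    (hT : T.generatorGraph = dirichletLaplacianGraph 𝕜) (hR : T.IsBoundedPerturbation W R)
    (hW : ∀ x, 0 < x → |W x| ≤ Q x) (t : ℝ≥0) (f : HalfLineL2 𝕜) :
    ∫ x in Ioi (0 : ℝ), ρ x * ‖R.op t f x‖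
      ≤ Real.exp (κ ^ 2 * t) * ∫ x in Ioi (0 : ℝ), ρ x * ‖f x‖ := by
  set D := ∫ x in Ioi (0 : ℝ), Q x * ρ x
  set I := ∫ x in Ioi (0 : ℝ), ρ x
  -- Both errors, δI from replacing the modulus and δD from the potential, are linear in δ and
  -- disappear as δ → 0.
  have main : ∀ δ : ℝ, 0 < δ → ∫ x in Ioi (0 : ℝ), ρ x * ‖R.op t f x‖
      ≤ δ * I + gronwallBound (∫ x in Ioi (0 : ℝ), ρ x * ‖f x‖) (κ ^ 2) (δ * D) t := by
    intro δ hδ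
    have h1 := R.le_gronwallBound_of_convex
      (F := fun u => inner ℝ (h.memLp.toLp _) (regAbsLp hδ u))
      (G := fun u => mulOp h.memLp_top (regSignLp hδ u))
      (continuous_const.inner (continuous_regAbsLp hδ))
      ((mulOp h.memLp_top).continuous.comp (continuous_regSignLp hδ))
      (h.inner_sub_le_re_inner hδ)
      (fun u y huy => h.re_inner_le_of_isBoundedPerturbation hδ hT hR hW huy) t f
    have h2 : ∫ x in Ioi (0 : ℝ), ρ x * ‖R.op t f x‖
        ≤ inner ℝ (h.memLp.toLp _) (regAbsLp hδ (R.op t f)) + δ * I := by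
      rw [inner_regAbsLp, ← integral_const_mul, ← integral_add
        (integrable_mul_regAbs hδ h.memLp _) (h.integrable.const_mul δ)]
      refine setIntegral_mono_on (h.integrable_mul_norm _)
        ((integrable_mul_regAbs hδ h.memLp _).add (h.integrable.const_mul δ)) measurableSet_Ioi
        fun x hx => ?_
      have := mul_le_mul_of_nonneg_left (norm_sub_le_regAbs hδ (R.op t f x)) (h.nonneg x hx)
      linarith
    have h3 : inner ℝ (h.memLp.toLp _) (regAbsLp hδ f) ≤ ∫ x in Ioi (0 : ℝ), ρ x * ‖f x‖ := by
      rw [inner_regAbsLp]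
      refine setIntegral_mono_on (integrable_mul_regAbs hδ h.memLp _) (h.integrable_mul_norm _)
        measurableSet_Ioi fun x hx => ?_
      exact mul_le_mul_of_nonneg_left (regAbs_le_norm hδ _) (h.nonneg x hx)
    rw [C0Semigroup.gronwallBound_eq_add] at h1 ⊢
    have h4 := mul_le_mul_of_nonneg_right h3 (Real.exp_nonneg (κ ^ 2 * t))
    linarith
  have hc : Continuous fun δ : ℝ =>
      δ * I + gronwallBound (∫ x in Ioi (0 : ℝ), ρ x * ‖f x‖) (κ ^ 2) (δ * D) t :=
    (continuous_id.mul continuous_const).add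
      ((gronwallBound_continuous_ε _ _ _).comp (continuous_id.mul continuous_const))
  have hlim := (hc.tendsto 0).mono_left (nhdsWithin_le_nhds (s := Ioi 0))
  simp only [zero_mul, zero_add, gronwallBound_ε0] at hlim
  rw [mul_comm]
  exact ge_of_tendsto hlim (by filter_upwards [self_mem_nhdsWithin] with δ hδ using main δ hδ)

end IsSuperWeight

end WeightedGronwall

/-! ### The damped exponential weight -/

section BaseWeight

/-- The weight `1 / (e^{-ξx} + θ e^{κx})`, which increases to `e^{ξx}` as `θ → 0`. -/
noncomputable def baseWeight (ξ κ θ x : ℝ) : ℝ := (Real.exp (-ξ * x) + θ * Real.exp (κ * x))⁻¹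

variable {ξ κ θ : ℝ}

theorem baseWeight_pos (hθ : 0 < θ) (x : ℝ) : 0 < baseWeight ξ κ θ x := by
  unfold baseWeight; positivity

theorem baseWeight_le_exp (hθ : 0 < θ) (x : ℝ) : baseWeight ξ κ θ x ≤ Real.exp (ξ * x) := by
  have h : Real.exp (ξ * x) = (Real.exp (-ξ * x))⁻¹ := by rw [← Real.exp_neg]; congr 1; ring
  rw [h]
  exact inv_anti₀ (Real.exp_pos _) (le_add_of_nonneg_right (by positivity))

theorem baseWeight_le_decay (hθ : 0 < θ) (x : ℝ) :
    baseWeight ξ κ θ x ≤ θ⁻¹ * Real.exp (-κ * x) := by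
  have h : θ⁻¹ * Real.exp (-κ * x) = (θ * Real.exp (κ * x))⁻¹ := by
    rw [mul_inv, ← Real.exp_neg]; congr 2; ring
  rw [h]
  exact inv_anti₀ (by positivity) (le_add_of_nonneg_left (Real.exp_pos _).le)

/-- Since |ξ| ≤ κ, moving by at most d changes each exponential in the denominator by a factor of at
most exp(κd). This is what moves the weight out of the Green integrals. -/
theorem baseWeight_harnack (hθ : 0 < θ) (hξ : |ξ| ≤ κ) {x y d : ℝ} (hd : |x - y| ≤ d) :
    Real.exp (-κ * d) * baseWeight ξ κ θ y ≤ baseWeight ξ κ θ x := by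
  have hκ : 0 ≤ κ := (abs_nonneg _).trans hξ
  obtain ⟨h1, h2⟩ := abs_le.1 hd
  have h3 : -ξ * (x - y) ≤ κ * d := by
    refine (le_abs_self _).trans ?_
    rw [abs_mul, abs_neg]
    exact mul_le_mul hξ hd (abs_nonneg _) hκ
  have h4 : κ * (x - y) ≤ κ * d := mul_le_mul_of_nonneg_left h2 hκ
  have hx : 0 < Real.exp (-ξ * x) + θ * Real.exp (κ * x) := by positivity
  have hy : 0 < Real.exp (-ξ * y) + θ * Real.exp (κ * y) := by positivity
  have e1 : Real.exp (-ξ * x) ≤ Real.exp (κ * d) * Real.exp (-ξ * y) := by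
    rw [← Real.exp_add]; exact Real.exp_le_exp.2 (by linarith)
  have e2 : Real.exp (κ * x) ≤ Real.exp (κ * d) * Real.exp (κ * y) := by
    rw [← Real.exp_add]; exact Real.exp_le_exp.2 (by linarith)
  have e3 : Real.exp (-ξ * x) + θ * Real.exp (κ * x)
      ≤ Real.exp (κ * d) * (Real.exp (-ξ * y) + θ * Real.exp (κ * y)) := by
    have := mul_le_mul_of_nonneg_left e2 hθ.le
    linarith
  have e4 : Real.exp (-κ * d) = (Real.exp (κ * d))⁻¹ := by rw [← Real.exp_neg]; congr 1; ring
  unfold baseWeight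
  rw [e4, ← mul_inv]
  exact inv_anti₀ hx e3

theorem contDiff_baseWeight (hθ : 0 < θ) : ContDiff ℝ ∞ (baseWeight ξ κ θ) := by
  unfold baseWeight
  refine ContDiff.inv (by fun_prop) fun x => ?_
  positivity

/-- With X = exp(−ξx) and Y = θ exp(κx), the inequality b'' ≤ κ²b for b = 1/(X+Y) amounts to
(κ²−ξ²)X² + (ξ+κ)(ξ+3κ)XY ≥ 0; the Y² terms cancel because the damping rate is exactly κ. -/
theorem deriv_baseWeight (hθ : 0 < θ) (hξ : |ξ| ≤ κ) :
    ∃ b' b'' : ℝ → ℝ, (∀ x, HasDerivAt (baseWeight ξ κ θ) (b' x) x) ∧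
      (∀ x, HasDerivAt b' (b'' x) x) ∧ (∀ x, |b' x| ≤ κ * baseWeight ξ κ θ x) ∧
      ∀ x, b'' x ≤ κ ^ 2 * baseWeight ξ κ θ x := by
  have hκ : 0 ≤ κ := (abs_nonneg _).trans hξ
  obtain ⟨hξ1, hξ2⟩ := abs_le.1 hξ
  set X : ℝ → ℝ := fun x => Real.exp (-ξ * x) with hX
  set Y : ℝ → ℝ := fun x => θ * Real.exp (κ * x) with hY
  have hXp : ∀ x, 0 < X x := fun x => Real.exp_pos _
  have hYp : ∀ x, 0 < Y x := fun x => by simp only [hY]; positivity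
  have dX : ∀ x, HasDerivAt X (-ξ * X x) x := fun x => by
    refine (((hasDerivAt_id x).const_mul (-ξ)).exp).congr_deriv ?_
    simp only [hX, id]; ring
  have dY : ∀ x, HasDerivAt Y (κ * Y x) x := fun x => by
    refine ((((hasDerivAt_id x).const_mul κ).exp).const_mul θ).congr_deriv ?_
    simp only [hY, id]; ring
  have d1 : ∀ x, HasDerivAt (fun x => X x + Y x) (-ξ * X x + κ * Y x) x := fun x =>
    (dX x).add (dY x)
  have d2 : ∀ x, HasDerivAt (fun x => -ξ * X x + κ * Y x) (ξ ^ 2 * X x + κ ^ 2 * Y x) x := fun x =>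
    (((dX x).const_mul (-ξ)).add ((dY x).const_mul κ)).congr_deriv (by ring)
  have hp : ∀ x, 0 < X x + Y x := fun x => add_pos (hXp x) (hYp x)
  refine ⟨fun x => -(-ξ * X x + κ * Y x) / (X x + Y x) ^ 2,
    fun x => (2 * (-ξ * X x + κ * Y x) ^ 2
      - (ξ ^ 2 * X x + κ ^ 2 * Y x) * (X x + Y x)) / (X x + Y x) ^ 3,
    fun x => (d1 x).fun_inv (hp x).ne', fun x => ?_, fun x => ?_, fun x => ?_⟩
  · have hpx := (hp x).ne'
    refine ((d2 x).fun_neg.fun_div ((d1 x).fun_pow 2) (pow_ne_zero 2 hpx)).congr_deriv ?_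
    field_simp
    ring
  · have hpx := hp x
    have h1 : |-ξ * X x + κ * Y x| ≤ κ * (X x + Y x) := by
      have := hXp x
      have := hYp x
      rw [abs_le]
      constructor <;> nlinarith
    rw [abs_div, abs_neg, abs_of_pos (pow_pos hpx 2), div_le_iff₀ (pow_pos hpx 2)]
    refine h1.trans (le_of_eq ?_)
    show _ = κ * (X x + Y x)⁻¹ * _
    field_simp
  · have hpx := hp x
    have h1 := hXp x
    have h2 := hYp x
    show _ ≤ κ ^ 2 * (X x + Y x)⁻¹
    rw [div_le_iff₀ (pow_pos hpx 3)]
    have e : κ ^ 2 * (X x + Y x)⁻¹ * (X x + Y x) ^ 3 = κ ^ 2 * (X x + Y x) ^ 2 := by field_simp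
    rw [e]
    have k1 : 0 ≤ (κ ^ 2 - ξ ^ 2) * X x ^ 2 :=
      mul_nonneg (by nlinarith) (sq_nonneg _)
    have k2 : 0 ≤ (ξ + κ) * (ξ + 3 * κ) * (X x * Y x) :=
      mul_nonneg (mul_nonneg (by linarith) (by linarith)) (mul_pos h1 h2).le
    nlinarith

end BaseWeight

/-! ### Construction of the supersolution -/

section Weight

theorem contDiff_primitive {f : ℝ → ℝ} (hf : ContDiff ℝ ∞ f) :
    ContDiff ℝ ∞ (fun x => ∫ y in (0 : ℝ)..x, f y) := by
  have hd : ∀ x, HasDerivAt (fun x => ∫ y in (0 : ℝ)..x, f y) (f x) x := fun x =>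
    (hf.continuous.integral_hasStrictDerivAt 0 x).hasDerivAt
  rw [contDiff_infty_iff_deriv]
  refine ⟨fun x => (hd x).differentiableAt, ?_⟩
  rwa [funext fun x => (hd x).deriv]

theorem sinh_le_mul_exp {s : ℝ} : Real.sinh s ≤ s * Real.exp s := by
  have h1 := Real.add_one_le_exp (-2 * s)
  have h2 : Real.exp (-s) = Real.exp s * Real.exp (-2 * s) := by
    rw [← Real.exp_add]; congr 1; ring
  have h3 := Real.exp_pos s
  rw [Real.sinh_eq, h2]
  nlinarith

theorem cosh_le_exp {s : ℝ} (hs : 0 ≤ s) : Real.cosh s ≤ Real.exp s := by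
  have : Real.exp (-s) ≤ Real.exp s := Real.exp_le_exp.2 (by linarith)
  rw [Real.cosh_eq]; linarith

/-- For a smooth potential `Q ≥ 0` with small first moment there is a supersolution comparable
to the base weight. -/
theorem exists_superWeight {ξ κ θ α : ℝ} (hκ : 0 < κ) (hξ : |ξ| ≤ κ) (hθ : 0 < θ) {Q : ℝ → ℝ}
    (hQ : ContDiff ℝ ∞ Q) (hQ0 : ∀ x, 0 ≤ Q x) (hQb : ∃ C, ∀ x, 0 < x → Q x ≤ C)
    (hQi : IntegrableOn Q (Ioi 0)) (hQ1 : IntegrableOn (fun x => x * Q x) (Ioi 0))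
    (hα : ∫ x in Ioi (0 : ℝ), x * Q x ≤ α) (hα1 : α < 1) :
    ∃ ρ, IsSuperWeight ρ Q κ ∧ ∀ x, 0 < x → baseWeight ξ κ θ x ≤ ρ x ∧
      ρ x ≤ 1 / (1 - α) * baseWeight ξ κ θ x := by
  set b := baseWeight ξ κ θ with hb
  have hb0 : ∀ x, 0 < b x := baseWeight_pos hθ
  have hbC : ContDiff ℝ ∞ b := contDiff_baseWeight hθ
  obtain ⟨b', b'', db, db', hb', hb''⟩ := deriv_baseWeight (ξ := ξ) (κ := κ) hθ hξ
  rw [← hb] at db hb' hb''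
  set r : ℝ → ℝ := fun x => Q x * b x with hr
  have hrC : ContDiff ℝ ∞ r := hQ.mul hbC
  have hr0 : ∀ x, 0 ≤ r x := fun x => mul_nonneg (hQ0 x) (hb0 x).le
  set p : ℝ → ℝ := fun y => Real.sinh (κ * y) * r y with hp
  set q : ℝ → ℝ := fun y => Real.exp (-κ * y) * r y with hq
  have hpC : ContDiff ℝ ∞ p := (Real.contDiff_sinh.comp (contDiff_const.mul contDiff_id)).mul hrC
  have hqC : ContDiff ℝ ∞ q := (Real.contDiff_exp.comp (contDiff_const.mul contDiff_id)).mul hrC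
  have hq0 : ∀ y, 0 ≤ q y := fun y => mul_nonneg (Real.exp_pos _).le (hr0 y)
  have q_le : ∀ x y, x ≤ y → q y ≤ Real.exp (-κ * x) * b x * Q y := by
    intro x y hxy
    have h := baseWeight_harnack (κ := κ) (ξ := ξ) hθ hξ (x := x) (y := y) (d := y - x)
      (by rw [abs_sub_comm, abs_of_nonneg (sub_nonneg.2 hxy)])
    have e : Real.exp (-κ * y) = Real.exp (-κ * x) * Real.exp (-κ * (y - x)) := by
      rw [← Real.exp_add]; congr 1; ring
    have := mul_le_mul_of_nonneg_left h (mul_nonneg (Real.exp_pos (-κ * x)).le (hQ0 y))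
    simp only [hq, hr]
    rw [e]
    linarith
  have hqi : IntegrableOn q (Ioi 0) := by
    refine (hQi.const_mul (Real.exp (-κ * 0) * b 0)).mono' hqC.continuous.aestronglyMeasurable ?_
    filter_upwards [ae_restrict_mem measurableSet_Ioi] with y hy
    rw [Real.norm_of_nonneg (hq0 y)]
    exact q_le 0 y (le_of_lt hy)
  set P : ℝ → ℝ := fun x => ∫ y in (0 : ℝ)..x, p y with hP
  -- For x > 0 this is ∫_x^∞ q; written as a difference it is smooth on all of ℝ.
  set R : ℝ → ℝ := fun x => (∫ y in Ioi (0 : ℝ), q y) - ∫ y in (0 : ℝ)..x, q y with hR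
  have dP : ∀ x, HasDerivAt P (p x) x := fun x =>
    (hpC.continuous.integral_hasStrictDerivAt 0 x).hasDerivAt
  have dR : ∀ x, HasDerivAt R (-q x) x := fun x =>
    ((hqC.continuous.integral_hasStrictDerivAt 0 x).hasDerivAt).const_sub _
  have hR_eq : ∀ x, 0 < x → R x = ∫ y in Ioi x, q y := by
    intro x hx
    have h := setIntegral_union (μ := volume) (f := q) (Ioc_disjoint_Ioi (le_refl x))
      measurableSet_Ioi (hqi.mono_set Ioc_subset_Ioi_self) (hqi.mono_set (Ioi_subset_Ioi hx.le))
      (s := Ioc 0 x)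
    rw [Ioc_union_Ioi_eq_Ioi hx.le] at h
    simp only [hR]
    rw [h, intervalIntegral.integral_of_le hx.le]
    ring
  -- Variation of constants: z is the Green integral of r = Qb for κ² − d²/dx² with Dirichlet
  -- condition at 0.
  set z : ℝ → ℝ := fun x => κ⁻¹ * (Real.exp (-κ * x) * P x + Real.sinh (κ * x) * R x) with hz
  set z' : ℝ → ℝ := fun x => -(Real.exp (-κ * x) * P x) + Real.cosh (κ * x) * R x with hz'
  have dE : ∀ x, HasDerivAt (fun x => Real.exp (-κ * x)) (-κ * Real.exp (-κ * x)) x := fun x =>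
    (((hasDerivAt_id x).const_mul (-κ)).exp).congr_deriv (by simp only [id]; ring)
  have dS : ∀ x, HasDerivAt (fun x => Real.sinh (κ * x)) (κ * Real.cosh (κ * x)) x := fun x =>
    (((hasDerivAt_id x).const_mul κ).sinh).congr_deriv (by simp only [id]; ring)
  have dC : ∀ x, HasDerivAt (fun x => Real.cosh (κ * x)) (κ * Real.sinh (κ * x)) x := fun x =>
    (((hasDerivAt_id x).const_mul κ).cosh).congr_deriv (by simp only [id]; ring)
  have dz : ∀ x, HasDerivAt z (z' x) x := fun x => by
    refine ((((dE x).fun_mul (dP x)).fun_add ((dS x).fun_mul (dR x))).const_mul κ⁻¹).congr_deriv ?_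
    simp only [hz', hp, hq]
    field_simp
    ring
  have dz' : ∀ x, HasDerivAt z' (κ ^ 2 * z x - r x) x := fun x => by
    refine (((dE x).fun_mul (dP x)).fun_neg.fun_add ((dC x).fun_mul (dR x))).congr_deriv ?_
    have e : Real.exp (-κ * x) * (Real.sinh (κ * x) + Real.cosh (κ * x)) = 1 := by
      rw [Real.sinh_add_cosh, ← Real.exp_add]; simp
    have hk : κ ^ 2 * κ⁻¹ = κ := by field_simp
    simp only [hz, hp, hq]
    linear_combination (-(r x)) * e - (Real.exp (-κ * x) * P x + Real.sinh (κ * x) * R x) * hk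
  have hzC : ContDiff ℝ ∞ z := by
    refine contDiff_const.mul (ContDiff.add (ContDiff.mul ?_ (contDiff_primitive hpC))
      (ContDiff.mul ?_ (contDiff_const.sub (contDiff_primitive hqC))))
    · exact Real.contDiff_exp.comp (contDiff_const.mul contDiff_id)
    · exact Real.contDiff_sinh.comp (contDiff_const.mul contDiff_id)
  set A := ∫ x in Ioi (0 : ℝ), Q x with hA
  have hA0 : 0 ≤ A := integral_nonneg hQ0
  have hα0 : 0 ≤ α := (setIntegral_nonneg measurableSet_Ioi
    fun x hx => mul_nonneg (le_of_lt hx) (hQ0 x)).trans hα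
  -- bounds for the two parts of `z`
  have hP0 : ∀ x, 0 < x → 0 ≤ P x := fun x hx =>
    intervalIntegral.integral_nonneg hx.le fun y hy =>
      mul_nonneg (Real.sinh_nonneg_iff.2 (mul_nonneg hκ.le hy.1)) (hr0 y)
  have hR0 : ∀ x, 0 < x → 0 ≤ R x := fun x hx => by
    rw [hR_eq x hx]
    exact integral_nonneg hq0
  have hsub : ∀ x : ℝ, 0 < x → (∫ y in (0 : ℝ)..x, y * Q y) + (∫ y in Ioi x, y * Q y) ≤ α := by
    intro x hx
    have h := setIntegral_union (μ := volume) (f := fun y => y * Q y)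
      (Ioc_disjoint_Ioi (le_refl x)) measurableSet_Ioi (hQ1.mono_set Ioc_subset_Ioi_self)
      (hQ1.mono_set (Ioi_subset_Ioi hx.le)) (s := Ioc 0 x)
    rw [Ioc_union_Ioi_eq_Ioi hx.le] at h
    rw [intervalIntegral.integral_of_le hx.le, ← h]
    exact hα
  -- For y ≤ x the kernel is at most y exp(−κ(x−y)), and exp(−κ(x−y)) b(y) ≤ b(x).
  have hP_le : ∀ x, 0 < x → κ⁻¹ * (Real.exp (-κ * x) * P x) ≤ b x * ∫ y in (0 : ℝ)..x, y * Q y := by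
    intro x hx
    rw [← mul_assoc, hP, ← intervalIntegral.integral_const_mul, ← intervalIntegral.integral_const_mul]
    refine intervalIntegral.integral_mono_on hx.le
      ((continuous_const.mul hpC.continuous).intervalIntegrable _ _)
      ((continuous_const.mul (continuous_id.mul hQ.continuous)).intervalIntegrable _ _)
      fun y hy => ?_
    have h1 : Real.sinh (κ * y) ≤ κ * y * Real.exp (κ * y) := sinh_le_mul_exp
    have h2 := baseWeight_harnack (κ := κ) (ξ := ξ) hθ hξ (x := x) (y := y) (d := x - y)
      (by rw [abs_of_nonneg (sub_nonneg.2 hy.2)])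
    have h3 : Real.exp (-κ * (x - y)) = Real.exp (-κ * x) * Real.exp (κ * y) := by
      rw [← Real.exp_add]; congr 1; ring
    rw [h3] at h2
    calc κ⁻¹ * Real.exp (-κ * x) * p y
        = κ⁻¹ * Real.exp (-κ * x) * r y * Real.sinh (κ * y) := by simp only [hp]; ring
      _ ≤ κ⁻¹ * Real.exp (-κ * x) * r y * (κ * y * Real.exp (κ * y)) := by
          refine mul_le_mul_of_nonneg_left h1 (mul_nonneg (by positivity) (hr0 y))
      _ = y * Q y * (Real.exp (-κ * x) * Real.exp (κ * y) * b y) := by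
          simp only [hr]; field_simp
      _ ≤ y * Q y * b x := mul_le_mul_of_nonneg_left h2 (mul_nonneg hy.1 (hQ0 y))
      _ = _ := by ring
  -- For y > x the kernel is at most x exp(−κ(y−x)); the Harnack bound applies again, and x ≤ y.
  have hR_le : ∀ x, 0 < x → κ⁻¹ * (Real.sinh (κ * x) * R x) ≤ b x * ∫ y in Ioi x, y * Q y := by
    intro x hx
    rw [← mul_assoc, hR_eq x hx, ← integral_const_mul, ← integral_const_mul]
    refine setIntegral_mono_on ((hqi.mono_set (Ioi_subset_Ioi hx.le)).const_mul _)
      ((hQ1.mono_set (Ioi_subset_Ioi hx.le)).const_mul _) measurableSet_Ioi fun y hy => ?_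
    have hxy : x ≤ y := le_of_lt hy
    have h1 : Real.sinh (κ * x) ≤ κ * x * Real.exp (κ * x) := sinh_le_mul_exp
    have h3 : Real.exp (κ * x) * Real.exp (-κ * x) = 1 := by rw [← Real.exp_add]; simp
    calc κ⁻¹ * Real.sinh (κ * x) * q y
        ≤ κ⁻¹ * (κ * x * Real.exp (κ * x)) * (Real.exp (-κ * x) * b x * Q y) := by
          gcongr
          · exact hq0 y
          · exact q_le x y hxy
      _ = x * (b x * Q y) * (Real.exp (κ * x) * Real.exp (-κ * x)) := by field_simp
      _ ≤ y * (b x * Q y) := by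
          rw [h3, mul_one]
          exact mul_le_mul_of_nonneg_right hxy (mul_nonneg (hb0 x).le (hQ0 y))
      _ = _ := by ring
  have hz0 : ∀ x, 0 < x → 0 ≤ z x := fun x hx => by
    have h1 := hP0 x hx
    have h2 := hR0 x hx
    have h3 : 0 ≤ Real.sinh (κ * x) := Real.sinh_nonneg_iff.2 (by positivity)
    simp only [hz]
    positivity
  have hz_le : ∀ x, 0 < x → z x ≤ α * b x := fun x hx => by
    have h1 := hP_le x hx
    have h2 := hR_le x hx
    have h3 := mul_le_mul_of_nonneg_left (hsub x hx) (hb0 x).le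
    simp only [hz]
    linarith
  have hz'_le : ∀ x, 0 < x → |z' x| ≤ (κ * α + A) * b x := fun x hx => by
    have h1 := hP_le x hx
    have h2 : Real.cosh (κ * x) * R x ≤ b x * A := by
      have h3 : ∫ y in Ioi x, Q y ≤ A :=
        setIntegral_mono_set hQi (Eventually.of_forall hQ0) (Ioi_subset_Ioi hx.le).eventuallyLE
      refine le_trans ?_ (mul_le_mul_of_nonneg_left h3 (hb0 x).le)
      rw [hR_eq x hx, ← integral_const_mul, ← integral_const_mul]
      refine setIntegral_mono_on ((hqi.mono_set (Ioi_subset_Ioi hx.le)).const_mul _)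
        ((hQi.mono_set (Ioi_subset_Ioi hx.le)).const_mul _) measurableSet_Ioi fun y hy => ?_
      have h3 : Real.exp (κ * x) * Real.exp (-κ * x) = 1 := by rw [← Real.exp_add]; simp
      calc Real.cosh (κ * x) * q y ≤ Real.exp (κ * x) * (Real.exp (-κ * x) * b x * Q y) :=
            mul_le_mul (cosh_le_exp (by positivity)) (q_le x y (le_of_lt hy)) (hq0 y)
              (Real.exp_pos _).le
        _ = (Real.exp (κ * x) * Real.exp (-κ * x)) * (b x * Q y) := by ring
        _ = _ := by rw [h3, one_mul]
    have h4 : 0 ≤ ∫ y in Ioi x, y * Q y := setIntegral_nonneg measurableSet_Ioi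
      fun y hy => mul_nonneg (hx.le.trans (le_of_lt hy)) (hQ0 y)
    have h5 : b x * (∫ y in (0 : ℝ)..x, y * Q y) ≤ b x * α :=
      mul_le_mul_of_nonneg_left (by linarith [hsub x hx]) (hb0 x).le
    have h6 : Real.exp (-κ * x) * P x ≤ κ * (b x * α) := by
      have := mul_le_mul_of_nonneg_left (h1.trans h5) hκ.le
      rwa [← mul_assoc, mul_inv_cancel₀ hκ.ne', one_mul] at this
    have h7 : 0 ≤ Real.exp (-κ * x) * P x := mul_nonneg (Real.exp_pos _).le (hP0 x hx)
    have h8 : 0 ≤ Real.cosh (κ * x) * R x := mul_nonneg (Real.cosh_pos _).le (hR0 x hx)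
    simp only [hz']
    rw [abs_le]
    have h9 : 0 ≤ κ * (b x * α) := h7.trans h6
    have h10 : 0 ≤ b x * A := h8.trans h2
    constructor <;> linarith
  -- The constant solves 1 + cα = c, so z ≤ αb gives b + cz ≤ cb.
  set c := 1 / (1 - α) with hc
  have hα2 : 0 < 1 - α := by linarith
  have hc0 : 0 < c := by positivity
  have hc1 : 1 + c * α = c := by rw [hc]; field_simp; ring
  have hρ_le : ∀ x, 0 < x → b x + c * z x ≤ c * b x := fun x hx => by
    have h1 := mul_le_mul_of_nonneg_left (hz_le x hx) hc0.le
    have h2 : (1 + c * α) * b x = c * b x := by rw [hc1]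
    linarith
  have hρ_ge : ∀ x, 0 < x → b x ≤ b x + c * z x := fun x hx =>
    le_add_of_nonneg_right (mul_nonneg hc0.le (hz0 x hx))
  have dρ : ∀ x, HasDerivAt (fun x => b x + c * z x) (b' x + c * z' x) x := fun x =>
    (db x).fun_add ((dz x).const_mul c)
  have dρ' : ∀ x, HasDerivAt (fun x => b' x + c * z' x) (b'' x + c * (κ ^ 2 * z x - r x)) x :=
    fun x => (db' x).fun_add ((dz' x).const_mul c)
  have hbθ : ∀ x, 0 < x → b x ≤ θ⁻¹ := fun x hx => by
    refine (baseWeight_le_decay hθ x).trans (mul_le_of_le_one_right (by positivity) ?_)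
    rw [Real.exp_le_one_iff]
    nlinarith
  have hρC : ContDiff ℝ ∞ (fun x => b x + c * z x) := hbC.add (contDiff_const.mul hzC)
  refine ⟨fun x => b x + c * z x, ⟨hρC, fun x hx => (hb0 x).le.trans (hρ_ge x hx),
    ⟨c * θ⁻¹, fun x hx => (hρ_le x hx).trans (mul_le_mul_of_nonneg_left (hbθ x hx) hc0.le)⟩,
    ⟨(κ + c * (κ * α + A)) * θ⁻¹, fun x hx => ?_⟩, ?_, hQ.continuous.aemeasurable,
    fun x _ => hQ0 x, hQb, fun x hx => ?_⟩, fun x hx => ⟨hρ_ge x hx, hρ_le x hx⟩⟩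
  · rw [(dρ x).deriv]
    calc |b' x + c * z' x| ≤ |b' x| + c * |z' x| := by
          refine (abs_add_le _ _).trans (le_of_eq ?_)
          rw [abs_mul, abs_of_pos hc0]
      _ ≤ κ * b x + c * ((κ * α + A) * b x) := by
          gcongr
          · exact hb' x
          · exact hz'_le x hx
      _ = (κ + c * (κ * α + A)) * b x := by ring
      _ ≤ _ := mul_le_mul_of_nonneg_left (hbθ x hx) (by positivity)
  · have h1 : IntegrableOn (fun x => c * (θ⁻¹ * Real.exp (-κ * x))) (Ioi 0) :=
      ((exp_neg_integrableOn_Ioi 0 hκ).const_mul _).const_mul _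
    refine h1.mono' hρC.continuous.aestronglyMeasurable ?_
    filter_upwards [ae_restrict_mem measurableSet_Ioi] with x hx
    rw [Real.norm_of_nonneg ((hb0 x).le.trans (hρ_ge x hx))]
    exact (hρ_le x hx).trans (mul_le_mul_of_nonneg_left (baseWeight_le_decay hθ x) hc0.le)
  -- ρ'' ≤ κ²b + cκ²z − cQb = κ²ρ − cQb, and cQb ≥ Qρ because ρ ≤ cb.
  · rw [funext fun x => (dρ x).deriv, (dρ' x).deriv]
    have h1 := mul_le_mul_of_nonneg_left (hρ_le x hx) (hQ0 x)
    have h2 := hb'' x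
    simp only [hr]
    linarith

end Weight

/-! ### Approximation by smooth potentials -/

section Approximation

/-- The first moment is the L_1-norm for the locally finite measure x dx on (0, ∞), and smooth
compactly supported functions are dense there. Smoothness is needed so that the supersolution is
smooth and Kato's argument yields genuine test functions. -/
theorem exists_smooth_firstMoment_sub_le {V : ℝ → ℝ} (hV : AEMeasurable V halfLineMeasure) {α : ℝ}
    (hα : FirstMomentLE V α) {ε : ℝ} (hε : 0 < ε) :
    ∃ q : ℝ → ℝ, ContDiff ℝ ∞ q ∧ HasCompactSupport q ∧ FirstMomentLE (fun x => V x - q x) ε := by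
  set μ := halfLineMeasure.withDensity (fun x => ENNReal.ofReal x) with hμ
  have : IsLocallyFiniteMeasure μ :=
    IsLocallyFiniteMeasure.withDensity_ofReal (f := fun x => x) continuous_id
  have key : ∀ W : ℝ → ℝ, AEMeasurable W halfLineMeasure →
      eLpNorm W 1 μ = ∫⁻ x in Ioi (0 : ℝ), ENNReal.ofReal (x * |W x|) := by
    intro W hW
    rw [eLpNorm_one_eq_lintegral_enorm, hμ,
      lintegral_withDensity_eq_lintegral_mul₀ (by fun_prop) (by fun_prop)]
    refine setLIntegral_congr_fun measurableSet_Ioi fun x hx => ?_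
    rw [Pi.mul_apply, Real.enorm_eq_ofReal_abs, ENNReal.ofReal_mul (le_of_lt hx)]
  have hVp : MemLp V 1 μ := by
    refine ⟨hV.aestronglyMeasurable.mono_ac (withDensity_absolutelyContinuous _ _), ?_⟩
    rw [key V hV]
    exact hα.trans_lt ENNReal.ofReal_lt_top
  obtain ⟨q, hq1, hq2, hq3⟩ := hVp.exist_eLpNorm_sub_le ENNReal.one_ne_top le_rfl hε
  refine ⟨q, hq2, hq1, ?_⟩
  rw [key _ (hV.sub hq2.continuous.aemeasurable)] at hq3
  exact hq3

theorem integrableOn_mul_exp_neg : IntegrableOn (fun x : ℝ => x * Real.exp (-x)) (Ioi 0) := by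
  refine (Real.GammaIntegral_convergent (s := 2) two_pos).congr_fun (fun x _ => ?_) measurableSet_Ioi
  norm_num [mul_comm]

theorem integral_mul_exp_neg : ∫ x in Ioi (0 : ℝ), x * Real.exp (-x) = 1 := by
  rw [← Real.Gamma_two, Real.Gamma_eq_integral two_pos]
  refine setIntegral_congr_fun measurableSet_Ioi fun x _ => ?_
  norm_num [mul_comm]

/-- A smooth, compactly supported function has a smooth majorant with almost the same first
moment. -/
theorem exists_smooth_majorant {q : ℝ → ℝ} (hq : ContDiff ℝ ∞ q) (hqs : HasCompactSupport q)
    {α : ℝ} (hα0 : 0 ≤ α) (hα : FirstMomentLE q α) {ε : ℝ} (hε : 0 < ε) :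
    ∃ Q : ℝ → ℝ, ContDiff ℝ ∞ Q ∧ (∀ x, 0 ≤ Q x) ∧ (∀ x, |q x| ≤ Q x) ∧
      (∃ C, ∀ x, 0 < x → Q x ≤ C) ∧ IntegrableOn Q (Ioi 0) ∧
      IntegrableOn (fun x => x * Q x) (Ioi 0) ∧ ∫ x in Ioi (0 : ℝ), x * Q x ≤ α + ε := by
  -- The term ε exp(−x) keeps the radicand positive, hence Q smooth, and adds at most ε∫x exp(−x) dx
  -- = ε to the first moment.
  set Q : ℝ → ℝ := fun x => √(q x ^ 2 + (ε * Real.exp (-x)) ^ 2) with hQdef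
  have hQ : ContDiff ℝ ∞ Q := by
    refine ContDiff.sqrt (by fun_prop) fun x => ?_
    positivity
  have hQ0 : ∀ x, 0 ≤ Q x := fun x => Real.sqrt_nonneg _
  have hQ_le : ∀ x, Q x ≤ |q x| + ε * Real.exp (-x) := fun x => by
    refine Real.sqrt_le_iff.2 ⟨by positivity, ?_⟩
    have : 0 ≤ |q x| * (ε * Real.exp (-x)) := by positivity
    nlinarith [sq_abs (q x)]
  obtain ⟨C, hC⟩ := hq.continuous.bounded_above_of_compact_support hqs
  have hqi : IntegrableOn (fun x => |q x|) (Ioi 0) :=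
    (hq.continuous.integrable_of_hasCompactSupport hqs).abs.integrableOn
  have hqi1 : IntegrableOn (fun x => x * |q x|) (Ioi 0) :=
    ((continuous_id.mul hq.continuous.abs).integrable_of_hasCompactSupport
      (HasCompactSupport.mul_left (hqs.comp_left abs_zero))).integrableOn
  have hei : IntegrableOn (fun x => ε * Real.exp (-x)) (Ioi 0) :=
    (integrableOn_exp_neg_Ioi 0).const_mul ε
  have hei1 : IntegrableOn (fun x => ε * (x * Real.exp (-x))) (Ioi 0) :=
    integrableOn_mul_exp_neg.const_mul ε
  have hmul : ∀ x, 0 < x → x * Q x ≤ x * |q x| + ε * (x * Real.exp (-x)) := fun x hx => by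
    have := mul_le_mul_of_nonneg_left (hQ_le x) hx.le
    linarith
  have hQ1 : IntegrableOn (fun x => x * Q x) (Ioi 0) := by
    refine (hqi1.add hei1).mono' (continuous_id.mul hQ.continuous).aestronglyMeasurable ?_
    filter_upwards [ae_restrict_mem measurableSet_Ioi] with x hx
    rw [Real.norm_of_nonneg (mul_nonneg (le_of_lt hx) (hQ0 x))]
    exact hmul x hx
  refine ⟨Q, hQ, hQ0, fun x => Real.abs_le_sqrt (le_add_of_nonneg_right (sq_nonneg _)),
    ⟨C + ε, fun x hx => ?_⟩, ?_, hQ1, ?_⟩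
  · refine (hQ_le x).trans (add_le_add (hC x) ?_)
    refine mul_le_of_le_one_right hε.le ?_
    rw [Real.exp_le_one_iff]; linarith
  · refine (hqi.add hei).mono' hQ.continuous.aestronglyMeasurable (Eventually.of_forall fun x => ?_)
    rw [Real.norm_of_nonneg (hQ0 x)]
    exact hQ_le x
  · have h1 : ∫ x in Ioi (0 : ℝ), x * |q x| ≤ α := by
      refine (ENNReal.ofReal_le_ofReal_iff hα0).1 ?_
      rw [ofReal_integral_eq_lintegral_ofReal hqi1]
      · exact hα
      · filter_upwards [ae_restrict_mem measurableSet_Ioi] with x hx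
        exact mul_nonneg (le_of_lt hx) (abs_nonneg _)
    calc ∫ x in Ioi (0 : ℝ), x * Q x
        ≤ ∫ x in Ioi (0 : ℝ), (x * |q x| + ε * (x * Real.exp (-x))) :=
          setIntegral_mono_on hQ1 (hqi1.add hei1) measurableSet_Ioi hmul
      _ = (∫ x in Ioi (0 : ℝ), x * |q x|) + ε := by
          rw [integral_add hqi1 hei1, integral_const_mul, integral_mul_exp_neg, mul_one]
      _ ≤ α + ε := by linarith

end Approximation

/-! ### The weighted L_1-bound for T_V -/

section WeightedBound

variable {𝕜 : Type*} [RCLike 𝕜] {ξ κ θ : ℝ}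

theorem memLp_baseWeight (hκ : 0 < κ) (hθ : 0 < θ) :
    MemLp (baseWeight ξ κ θ) 2 halfLineMeasure := by
  rw [memLp_two_iff_integrable_sq (contDiff_baseWeight hθ).continuous.aestronglyMeasurable]
  have h1 : IntegrableOn (fun x => θ⁻¹ ^ 2 * Real.exp (-(2 * κ) * x)) (Ioi 0) :=
    (exp_neg_integrableOn_Ioi 0 (by positivity)).const_mul _
  refine h1.mono' ((contDiff_baseWeight hθ).continuous.pow 2).aestronglyMeasurable
    (Eventually.of_forall fun x => ?_)
  rw [Real.norm_of_nonneg (sq_nonneg _)]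
  refine (pow_le_pow_left₀ (baseWeight_pos hθ x).le (baseWeight_le_decay hθ x) 2).trans
    (le_of_eq ?_)
  rw [mul_pow, ← Real.exp_nat_mul]
  congr 2
  push_cast
  ring

theorem integral_mul_norm_le {b : ℝ → ℝ} (hb : MemLp b 2 halfLineMeasure) (u : HalfLineL2 𝕜) :
    ∫ x in Ioi (0 : ℝ), b x * ‖u x‖ ≤ ‖hb.toLp b‖ * ‖u‖ := by
  set N : HalfLineL2 ℝ := lipschitzWith_one_norm.compLp norm_zero u with hN
  have h1 : ‖N‖ ≤ ‖u‖ := by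
    simpa using (lipschitzWith_one_norm (E := 𝕜)).norm_compLp_le norm_zero u
  have h2 : ∀ᵐ x ∂halfLineMeasure, N x = ‖u x‖ :=
    (lipschitzWith_one_norm (E := 𝕜)).coeFn_compLp norm_zero u
  have h3 : inner ℝ (hb.toLp b) N = ∫ x in Ioi (0 : ℝ), b x * ‖u x‖ := by
    rw [L2.inner_def]
    refine integral_congr_ae ?_
    filter_upwards [hb.coeFn_toLp, h2] with x a1 a2
    rw [a1, a2, RCLike.inner_apply, conj_trivial, mul_comm]
  rw [← h3]
  exact (real_inner_le_norm _ _).trans (mul_le_mul_of_nonneg_left h1 (norm_nonneg _))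

/-- V is replaced by a smooth q with error ε in first moment. Then q has moment at most α + ε and
its smooth majorant at most α + 2ε, so the supersolution estimate applies to T_q. As b lies in L_2,
the L_2-distance of T_V(t)f and T_q(t)f controls the rest, and ε → 0. -/
theorem integral_baseWeight_mul_norm_op_le {T S : C0Semigroup 𝕜 (HalfLineL2 𝕜)}
    (hT : T.generatorGraph = dirichletLaplacianGraph 𝕜) {V : ℝ → ℝ}
    (hV : AEMeasurable V halfLineMeasure) {α : ℝ} (hα0 : 0 ≤ α) (hα1 : α < 1)
    (hα : FirstMomentLE V α) (hS : T.IsPerturbation V S) (hκ : 0 < κ) (hξ : |ξ| ≤ κ) (hθ : 0 < θ)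
    (t : ℝ≥0) (f : HalfLineL2 𝕜) :
    ∫ x in Ioi (0 : ℝ), baseWeight ξ κ θ x * ‖S.op t f x‖
      ≤ 1 / (1 - α) * (Real.exp (κ ^ 2 * t) * ∫ x in Ioi (0 : ℝ), baseWeight ξ κ θ x * ‖f x‖) := by
  set b := baseWeight ξ κ θ with hb
  have hbm : MemLp b 2 halfLineMeasure := memLp_baseWeight hκ hθ
  have hb0 : ∀ x, 0 < b x := baseWeight_pos hθ
  have hbi : ∀ u : HalfLineL2 𝕜, IntegrableOn (fun x => b x * ‖u x‖) (Ioi 0) := fun u =>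
    hbm.integrable_mul (Lp.memLp u).norm
  have main : ∀ ε : ℝ, 0 < ε → α + 2 * ε < 1 →
      ∫ x in Ioi (0 : ℝ), b x * ‖S.op t f x‖
        ≤ 1 / (1 - (α + 2 * ε)) * (Real.exp (κ ^ 2 * t) * ∫ x in Ioi (0 : ℝ), b x * ‖f x‖)
          + ‖hbm.toLp b‖ * (ε / (2 * (1 - (α + ε))) * ‖f‖) := by
    intro ε hε hε1
    obtain ⟨q, hq, hqs, hqV⟩ := exists_smooth_firstMoment_sub_le hV hα hε
    have hqα : FirstMomentLE q (α + ε) := by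
      refine hα.add hqV hV hα0 hε.le fun x => ?_
      have := abs_sub (V x) (V x - q x)
      rwa [sub_sub_cancel] at this
    obtain ⟨Q, hQ, hQ0, hqQ, hQb, hQi, hQ1, hQα⟩ :=
      exists_smooth_majorant hq hqs (by positivity) hqα hε
    obtain ⟨C, hC⟩ := hq.continuous.bounded_above_of_compact_support hqs
    obtain ⟨R, hR⟩ := C0Semigroup.exists_isBoundedPerturbation hT (W := q)
      (memLp_top_ofReal hq.continuous.aemeasurable (Eventually.of_forall hC))
    obtain ⟨ρ, hρ, hρb⟩ := exists_superWeight hκ hξ hθ hQ hQ0 hQb hQi hQ1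
      (hQα.trans (by linarith : _ ≤ α + 2 * ε)) hε1
    have e1 := hρ.integral_mul_norm_op_le hT hR (fun x _ => hqQ x) t f
    have e2 : ∫ x in Ioi (0 : ℝ), b x * ‖R.op t f x‖ ≤ ∫ x in Ioi (0 : ℝ), ρ x * ‖R.op t f x‖ :=
      setIntegral_mono_on (hbi _) (hρ.integrable_mul_norm _) measurableSet_Ioi fun x hx =>
        mul_le_mul_of_nonneg_right (hρb x hx).1 (norm_nonneg _)
    have e3 : ∫ x in Ioi (0 : ℝ), ρ x * ‖f x‖
        ≤ 1 / (1 - (α + 2 * ε)) * ∫ x in Ioi (0 : ℝ), b x * ‖f x‖ := by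
      rw [← integral_const_mul]
      refine setIntegral_mono_on (hρ.integrable_mul_norm _) ((hbi _).const_mul _)
        measurableSet_Ioi fun x hx => ?_
      rw [← mul_assoc]
      exact mul_le_mul_of_nonneg_right (hρb x hx).2 (norm_nonneg _)
    have e4 : ‖S.op t f - R.op t f‖ ≤ ε / (2 * (1 - (α + ε))) * ‖f‖ :=
      hS.norm_op_sub_op_le hT hV (by positivity) (by linarith)
        (hα.mono (by linarith) fun x => le_rfl) hq.continuous.aemeasurable hqα hR hε.le hqV t f
    have e5 : ∫ x in Ioi (0 : ℝ), b x * ‖S.op t f x‖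
        ≤ (∫ x in Ioi (0 : ℝ), b x * ‖R.op t f x‖)
          + ∫ x in Ioi (0 : ℝ), b x * ‖(S.op t f - R.op t f) x‖ := by
      rw [← integral_add (hbi _) (hbi _)]
      refine integral_mono_ae (hbi _) ((hbi _).add (hbi _)) ?_
      filter_upwards [Lp.coeFn_sub (S.op t f) (R.op t f)] with x hx
      rw [hx, Pi.sub_apply, ← mul_add]
      refine mul_le_mul_of_nonneg_left ?_ (hb0 x).le
      have := norm_add_le (R.op t f x) (S.op t f x - R.op t f x)
      rwa [add_sub_cancel] at this
    have e6 := integral_mul_norm_le hbm (S.op t f - R.op t f)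
    have e7 := mul_le_mul_of_nonneg_left e4 (norm_nonneg (hbm.toLp b))
    have e8 := mul_le_mul_of_nonneg_left e3 (Real.exp_nonneg (κ ^ 2 * t))
    linarith
  have hα2 : 1 - α ≠ 0 := by linarith
  have hlim : Tendsto (fun ε : ℝ =>
      1 / (1 - (α + 2 * ε)) * (Real.exp (κ ^ 2 * t) * ∫ x in Ioi (0 : ℝ), b x * ‖f x‖)
          + ‖hbm.toLp b‖ * (ε / (2 * (1 - (α + ε))) * ‖f‖)) (𝓝[>] 0)
      (𝓝 (1 / (1 - α) * (Real.exp (κ ^ 2 * t) * ∫ x in Ioi (0 : ℝ), b x * ‖f x‖))) := by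
    refine Tendsto.mono_left ?_ nhdsWithin_le_nhds
    have hc : ContinuousAt (fun ε : ℝ =>
      1 / (1 - (α + 2 * ε)) * (Real.exp (κ ^ 2 * t) * ∫ x in Ioi (0 : ℝ), b x * ‖f x‖)
          + ‖hbm.toLp b‖ * (ε / (2 * (1 - (α + ε))) * ‖f‖)) 0 := by
      have h1 : 1 - (α + 2 * (0 : ℝ)) ≠ 0 := by simpa using hα2
      have h2 : 2 * (1 - (α + (0 : ℝ))) ≠ 0 := by simpa using hα2
      fun_prop (disch := assumption)
    simpa using hc.tendsto
  refine ge_of_tendsto hlim ?_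
  have : Iio ((1 - α) / 2) ∈ 𝓝[>] (0 : ℝ) :=
    mem_nhdsWithin_of_mem_nhds (Iio_mem_nhds (by linarith))
  filter_upwards [self_mem_nhdsWithin, this] with ε h1 h2
  have h2 : ε < (1 - α) / 2 := h2
  exact main ε h1 (by linarith)

/-- The damping is removed with θ → 0 and κ → |ξ|: Fatou's lemma handles the left side, while b ≤
exp(ξx) bounds the initial value. -/
theorem lintegral_exp_mul_norm_op_le {T S : C0Semigroup 𝕜 (HalfLineL2 𝕜)}
    (hT : T.generatorGraph = dirichletLaplacianGraph 𝕜) {V : ℝ → ℝ}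
    (hV : AEMeasurable V halfLineMeasure) {α : ℝ} (hα0 : 0 ≤ α) (hα1 : α < 1)
    (hα : FirstMomentLE V α) (hS : T.IsPerturbation V S) (ξ : ℝ) (t : ℝ≥0) (f : HalfLineL2 𝕜)
    (hf : ∫⁻ x in Ioi (0 : ℝ), ENNReal.ofReal (Real.exp (ξ * x) * ‖f x‖) ≤ 1) :
    ∫⁻ x in Ioi (0 : ℝ), ENNReal.ofReal (Real.exp (ξ * x) * ‖S.op t f x‖)
      ≤ ENNReal.ofReal (1 / (1 - α) * Real.exp (|ξ| ^ 2 * t)) := by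
  set θ : ℕ → ℝ := fun n => 1 / ((n : ℝ) + 1) with hθdef
  have hθ : ∀ n, 0 < θ n := fun n => Nat.one_div_pos_of_nat
  have hθlim : Tendsto θ atTop (𝓝 0) := tendsto_one_div_add_atTop_nhds_zero_nat
  -- The summand θ n keeps the damping rate positive even for ξ = 0.
  set κ : ℕ → ℝ := fun n => |ξ| + θ n with hκdef
  have hκ : ∀ n, 0 < κ n := fun n => add_pos_of_nonneg_of_pos (abs_nonneg _) (hθ n)
  have hκlim : Tendsto κ atTop (𝓝 |ξ|) := by simpa using hθlim.const_add |ξ|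
  set b : ℕ → ℝ → ℝ := fun n => baseWeight ξ (κ n) (θ n) with hb
  have hbm : ∀ n, MemLp (b n) 2 halfLineMeasure := fun n => memLp_baseWeight (hκ n) (hθ n)
  have hb0 : ∀ n x, 0 < b n x := fun n => baseWeight_pos (hθ n)
  have hbi : ∀ n (u : HalfLineL2 𝕜), IntegrableOn (fun x => b n x * ‖u x‖) (Ioi 0) := fun n u =>
    (hbm n).integrable_mul (Lp.memLp u).norm
  have hblim : ∀ x, Tendsto (fun n => b n x) atTop (𝓝 (Real.exp (ξ * x))) := by
    intro x
    have h1 : Tendsto (fun n => Real.exp (-ξ * x) + θ n * Real.exp (κ n * x)) atTop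
        (𝓝 (Real.exp (-ξ * x) + 0 * Real.exp (|ξ| * x))) :=
      (hθlim.mul ((Real.continuous_exp.tendsto _).comp (hκlim.mul_const x))).const_add _
    have h2 := h1.inv₀ (by simp [Real.exp_ne_zero])
    rw [zero_mul, add_zero, ← Real.exp_neg, neg_mul, neg_neg] at h2
    simpa [hb, baseWeight] using h2
  have hof : ∀ n (u : HalfLineL2 𝕜), ∫⁻ x in Ioi (0 : ℝ), ENNReal.ofReal (b n x * ‖u x‖)
      = ENNReal.ofReal (∫ x in Ioi (0 : ℝ), b n x * ‖u x‖) := fun n u =>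
    (ofReal_integral_eq_lintegral_ofReal (hbi n u)
      (Eventually.of_forall fun x => mul_nonneg (hb0 n x).le (norm_nonneg _))).symm
  have hstep : ∀ n, ∫⁻ x in Ioi (0 : ℝ), ENNReal.ofReal (b n x * ‖S.op t f x‖)
      ≤ ENNReal.ofReal (1 / (1 - α) * Real.exp (κ n ^ 2 * t)) := by
    intro n
    have h1 : ∫ x in Ioi (0 : ℝ), b n x * ‖f x‖ ≤ 1 := by
      refine (ENNReal.ofReal_le_ofReal_iff zero_le_one).1 ?_
      rw [← hof, ENNReal.ofReal_one]
      refine le_trans (lintegral_mono fun x => ENNReal.ofReal_le_ofReal ?_) hf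
      exact mul_le_mul_of_nonneg_right (baseWeight_le_exp (hθ n) x) (norm_nonneg _)
    rw [hof]
    refine ENNReal.ofReal_le_ofReal ((integral_baseWeight_mul_norm_op_le hT hV hα0 hα1 hα hS (hκ n)
      (le_add_of_nonneg_right (hθ n).le) (hθ n) t f).trans ?_)
    have h2 : 0 ≤ 1 / (1 - α) := by
      have : 0 < 1 - α := by linarith
      positivity
    exact mul_le_mul_of_nonneg_left (mul_le_of_le_one_right (Real.exp_nonneg _) h1) h2
  have hlim : Tendsto (fun n => ENNReal.ofReal (1 / (1 - α) * Real.exp (κ n ^ 2 * t))) atTop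
      (𝓝 (ENNReal.ofReal (1 / (1 - α) * Real.exp (|ξ| ^ 2 * t)))) := by
    refine (ENNReal.continuous_ofReal.tendsto _).comp (Tendsto.const_mul _ ?_)
    exact (Real.continuous_exp.tendsto _).comp ((hκlim.pow 2).mul_const _)
  calc ∫⁻ x in Ioi (0 : ℝ), ENNReal.ofReal (Real.exp (ξ * x) * ‖S.op t f x‖)
      = ∫⁻ x in Ioi (0 : ℝ), liminf (fun n => ENNReal.ofReal (b n x * ‖S.op t f x‖)) atTop := by
        refine lintegral_congr fun x => ?_
        exact (((ENNReal.continuous_ofReal.tendsto _).comp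
          ((hblim x).mul_const _)).liminf_eq).symm
    _ ≤ liminf (fun n => ∫⁻ x in Ioi (0 : ℝ), ENNReal.ofReal (b n x * ‖S.op t f x‖)) atTop :=
        lintegral_liminf_le' fun n => (hbi n _).aestronglyMeasurable.aemeasurable.ennreal_ofReal
    _ ≤ liminf (fun n => ENNReal.ofReal (1 / (1 - α) * Real.exp (κ n ^ 2 * t))) atTop :=
        liminf_le_liminf (Eventually.of_forall hstep)
    _ = _ := hlim.liminf_eq

theorem weightedOpNorm_exp_le {T S : C0Semigroup 𝕜 (HalfLineL2 𝕜)}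
    (hT : T.generatorGraph = dirichletLaplacianGraph 𝕜) {V : ℝ → ℝ}
    (hV : AEMeasurable V halfLineMeasure) {α : ℝ} (hα0 : 0 ≤ α) (hα1 : α < 1)
    (hα : FirstMomentLE V α) (hS : T.IsPerturbation V S) (ξ : ℝ) (t : ℝ≥0) :
    weightedOpNorm (fun x => Real.exp (ξ * x)) (S.op t) 1 1
      ≤ ENNReal.ofReal (1 / (1 - α) * Real.exp (|ξ| ^ 2 * t)) := by
  have hnorm : ∀ (x : ℝ) (z : 𝕜),
      ‖((Real.exp (ξ * x) : ℝ) : 𝕜) * z‖ₑ = ENNReal.ofReal (Real.exp (ξ * x) * ‖z‖) := by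
    intro x z
    rw [← ofReal_norm, norm_mul, RCLike.norm_ofReal, Real.abs_exp]
  unfold weightedOpNorm
  refine iSup_le fun f => iSup_le fun hf => iSup_le fun hf1 => iSup_le fun hf2 => ?_
  rw [eLpNorm_one_eq_lintegral_enorm]
  simp only [hnorm]
  refine lintegral_exp_mul_norm_op_le hT hV hα0 hα1 hα hS ξ t _ (le_trans (le_of_eq ?_) hf1)
  rw [eLpNorm_one_eq_lintegral_enorm]
  refine lintegral_congr_ae ?_
  filter_upwards [hf2.coeFn_toLp] with x hx
  rw [hx, ← hnorm, mul_inv_cancel_left₀]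
  exact_mod_cast (Real.exp_pos _).ne'

end WeightedBound

theorem mainTheorem12 {𝕜 : Type*} [RCLike 𝕜]
    (T : C0Semigroup 𝕜 (HalfLineL2 𝕜))
    (hT : T.generatorGraph = dirichletLaplacianGraph 𝕜)
    (V : ℝ → ℝ) (hV : AEMeasurable V halfLineMeasure)
    (α : ℝ) (hα : α ∈ Ioo (0 : ℝ) 1)
    (hint : ∫⁻ x in Ioi (0 : ℝ), ENNReal.ofReal (x * |V x|) ≤ ENNReal.ofReal α) :
    T.IsAdmissible V ∧
    (∃ S : C0Semigroup 𝕜 (HalfLineL2 𝕜), T.IsPerturbation V S) ∧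
    ∀ S : C0Semigroup 𝕜 (HalfLineL2 𝕜), T.IsPerturbation V S →
      ∀ (ξ : ℝ) (t : ℝ≥0),
        weightedOpNorm (fun x => Real.exp (ξ * x)) (S.op t) 1 1
          ≤ ENNReal.ofReal (1 / (1 - α) * Real.exp (|ξ| ^ 2 * t)) := by
  have hα' : FirstMomentLE V α := hint
  have hex : ∀ W : ℝ → ℝ, AEMeasurable W halfLineMeasure → (∀ x, |W x| ≤ |V x|) →
      ∃ S, T.IsPerturbation W S := fun W hW hWV =>
    C0Semigroup.exists_isPerturbation hT hW hα.1.le hα.2 (hα'.mono le_rfl hWV)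
  refine ⟨⟨hex _ (hV.max aemeasurable_const) fun x => ?_,
    hex _ (hV.min aemeasurable_const) fun x => ?_⟩, hex V hV fun x => le_rfl,
    fun S hS ξ t => weightedOpNorm_exp_le hT hV hα.1.le hα.2 hα' hS ξ t⟩
  · exact abs_max_le_max_abs_abs.trans (by simp)
  · exact abs_min_le_max_abs_abs.trans (by simp)
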